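/- **Proposition 4.2 (flat totally geodesic, positive definite).** Identify the tangent space of $SL(2,\mathbb R)\times SL(2,\mathbb R)$ at $(A,B)$ with the pairs $(A\alpha,B\beta)$, where $\alpha,\beta$ are real $2\times2$ matrices of trace $0$. Put $\langle\alpha,\gamma\rangle=\tfrac12\operatorname{tr}(\alpha\gamma)$ and consider the nearly Kähler structure $$J(A\alpha,B\beta)=\tfrac1{\sqrt3}\bigl(A(\alpha-2\beta),\,B(2\alpha-\beta)\bigr),$$ $$g\bigl((A\alpha,B\beta),(A\gamma,B\delta)\bigr)=\tfrac23\bigl(\langle\alpha,\gamma\rangle+\langle\beta,\delta\rangle\bigr)-\tfrac13\bigl(\langle\beta,\gamma\rangle+\langle\alpha,\delta\rangle\bigr).$$ For $a,b,c\in SL(2,\mathbb R)$ the map $\Phi_{a,b,c}(p,q)=(apc,bqc)$ is an isometry of $g$ (commuting with $J$). Let $f:\mathbb R^2\to SL(2,\mathbb R)\times SL(2,\mathbb R)$ be the immersion $$f(s,t)=\left(\begin{pmatrix}e^{(\sqrt3s-t)/\sqrt2}&0\\0&e^{-(\sqrt3s-t)/\sqrt2}\end{pmatrix},\ \begin{pmatrix}e^{(\sqrt3s+t)/\sqrt2}&0\\0&e^{-(\sqrt3s+t)/\sqrt2}\end{pmatrix}\right).$$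 Let $M$ be a connected smooth surface and let $F:M\to SL(2,\mathbb R)\times SL(2,\mathbb R)$ be a smooth immersion which is almost complex (each tangent plane $dF(T_xM)$ is mapped into itself by $J$), whose induced metric $F^*g$ is positive definite, which is totally geodesic (its second fundamental form with respect to the Levi-Civita connection of $g$ vanishes), and which is flat (the Gaussian curvature of $F^*g$ is $0$). Then $F$ is, up to an isometry of $SL(2,\mathbb R)\times SL(2,\mathbb R)$, the immersion $f$: there are $a,b,c\in SL(2,\mathbb R)$ and a local diffeomorphism $\varphi:M\to\mathbb R^2$, which is a local isometry from $(M,F^*g)$ to the Euclidean plane $(\mathbb R^2,ds^2+dt^2)$, such that $F=\Phi_{a,b,c}\circ f\circ\varphi$ on all of $M$. -/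

import Mathlib

open scoped Manifold ContDiff

namespace NearlyKahlerSL2

/-- Real `2 × 2` matrices. -/
abbrev Mat2 : Type := Matrix (Fin 2) (Fin 2) ℝ

/-- The group `SL(2, ℝ)`. -/
abbrev SL2 : Type := Matrix.SpecialLinearGroup (Fin 2) ℝ

/-- The Euclidean plane, which is also the model space of surfaces. -/
abbrev Plane : Type := EuclideanSpace ℝ (Fin 2)

/-! ### The nearly Kähler structure of `SL(2, ℝ) × SL(2, ℝ)`

`SL(2, ℝ) × SL(2, ℝ)` is regarded as a submanifold of `Mat2 × Mat2`. A tangent vector at `(A, B)`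
is a pair `(A α, B β)` with `α`, `β` of trace zero. Smoothness and derivatives of maps into
`Mat2 × Mat2` are those of the matrix entries. -/

/-- The map `(A α, B β) ↦ (α, β)` on tangent vectors at `(A, B)`. -/
def leftTriv (p : SL2 × SL2) (Z : Mat2 × Mat2) : Mat2 × Mat2 :=
  (((p.1⁻¹ : SL2) : Mat2) * Z.1, ((p.2⁻¹ : SL2) : Mat2) * Z.2)

/-- The map `(α, β) ↦ (A α, B β)`. -/
def leftTranslate (p : SL2 × SL2) (X : Mat2 × Mat2) : Mat2 × Mat2 :=
  ((p.1 : Mat2) * X.1, (p.2 : Mat2) * X.2)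

/-- The inner product `⟨a, b⟩ = -(1/2) (a₁ b₄ - a₂ b₃ - a₃ b₂ + a₄ b₁)` on `2 × 2` matrices. -/
noncomputable def bil (a b : Mat2) : ℝ :=
  -(1 / 2) * (a 0 0 * b 1 1 - a 0 1 * b 1 0 - a 1 0 * b 0 1 + a 1 1 * b 0 0)

/-- `J (α, β) = (1/√3) (α - 2 β, 2 α - β)` on pairs of matrices. -/
noncomputable def algJ (X : Mat2 × Mat2) : Mat2 × Mat2 :=
  ((1 / √3) • (X.1 - (2 : ℝ) • X.2), (1 / √3) • ((2 : ℝ) • X.1 - X.2))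

/-- The almost complex structure `J (A α, B β) = (1/√3) (A (α - 2 β), B (2 α - β))`. -/
noncomputable def almostComplex (p : SL2 × SL2) (Z : Mat2 × Mat2) : Mat2 × Mat2 :=
  leftTranslate p (algJ (leftTriv p Z))

/-- The metric on pairs of matrices
`g((α, β), (γ, δ)) = (2/3) (⟨α, γ⟩ + ⟨β, δ⟩) - (1/3) (⟨β, γ⟩ + ⟨α, δ⟩)`. -/
noncomputable def algMetric (X Y : Mat2 × Mat2) : ℝ :=
  2 / 3 * (bil X.1 Y.1 + bil X.2 Y.2) - 1 / 3 * (bil X.2 Y.1 + bil X.1 Y.2)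

/-- The left-invariant nearly Kähler metric `g`, evaluated on tangent vectors at `p`. -/
noncomputable def metric (p : SL2 × SL2) (Z W : Mat2 × Mat2) : ℝ :=
  algMetric (leftTriv p Z) (leftTriv p W)

/-- `α × β = (1/2) (α β - β α)`. -/
noncomputable def cross (a b : Mat2) : Mat2 := (1 / 2 : ℝ) • (a * b - b * a)

/-- The Levi-Civita connection of `g` on left-invariant vector fields: if `X`, `Y` are the
left-invariant fields given by the pairs `(α, β)` and `(γ, δ)`, then the covariant derivative of `Y`
along `X` is the left-invariant field given by `algConn (α, β) (γ, δ)`.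
The lemmas `algConn_torsionFree` and `algConn_metric` are the two properties that characterize it. -/
noncomputable def algConn (X Y : Mat2 × Mat2) : Mat2 × Mat2 :=
  (cross X.1 Y.1 - (1 / 3 : ℝ) • cross X.1 Y.2 + (1 / 3 : ℝ) • cross X.2 Y.1,
   cross X.2 Y.2 + (1 / 3 : ℝ) • cross X.1 Y.2 - (1 / 3 : ℝ) • cross X.2 Y.1)

theorem algConn_torsionFree (X Y : Mat2 × Mat2) :
    algConn X Y - algConn Y X = (X.1 * Y.1 - Y.1 * X.1, X.2 * Y.2 - Y.2 * X.2) := by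
  refine Prod.ext ?_ ?_
  · simp only [algConn, cross, Prod.fst_sub]
    module
  · simp only [algConn, cross, Prod.snd_sub]
    module

theorem algConn_metric (X Y Z : Mat2 × Mat2) :
    algMetric (algConn X Y) Z + algMetric Y (algConn X Z) = 0 := by
  simp only [algMetric, bil, algConn, cross, Matrix.add_apply, Matrix.sub_apply, Matrix.smul_apply,
    smul_eq_mul, Matrix.mul_apply, Fin.sum_univ_two]
  ring

/-- The map `(p, q) ↦ (a p c, b q c)` of `SL(2, ℝ) × SL(2, ℝ)` onto itself. Its differential is
`(U, V) ↦ (a U c, b V c)`; by the two lemmas below it is an isometry that commutes with `J`. -/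
def congruence (a b c : SL2) (p : SL2 × SL2) : SL2 × SL2 := (a * p.1 * c, b * p.2 * c)

theorem leftTriv_congruence (a b c : SL2) (p : SL2 × SL2) (Z : Mat2 × Mat2) :
    leftTriv (congruence a b c p) ((a : Mat2) * Z.1 * (c : Mat2), (b : Mat2) * Z.2 * (c : Mat2)) =
      (((c⁻¹ : SL2) : Mat2) * (leftTriv p Z).1 * (c : Mat2),
       ((c⁻¹ : SL2) : Mat2) * (leftTriv p Z).2 * (c : Mat2)) := by
  have key : ∀ (a q : SL2) (U : Mat2), (((a * q * c)⁻¹ : SL2) : Mat2) * ((a : Mat2) * U * (c : Mat2))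
      = ((c⁻¹ : SL2) : Mat2) * (((q⁻¹ : SL2) : Mat2) * U) * (c : Mat2) := by
    intro a q U
    have h : ((a⁻¹ : SL2) : Mat2) * (a : Mat2) = 1 := by
      rw [← Matrix.SpecialLinearGroup.coe_mul, inv_mul_cancel, Matrix.SpecialLinearGroup.coe_one]
    rw [mul_inv_rev, mul_inv_rev, Matrix.SpecialLinearGroup.coe_mul,
      Matrix.SpecialLinearGroup.coe_mul]
    simp only [Matrix.mul_assoc]
    rw [← Matrix.mul_assoc ((a⁻¹ : SL2) : Mat2), h, Matrix.one_mul]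
  exact Prod.ext (key a p.1 Z.1) (key b p.2 Z.2)

theorem bil_conj (c : SL2) (x y : Mat2) :
    bil (((c⁻¹ : SL2) : Mat2) * x * (c : Mat2)) (((c⁻¹ : SL2) : Mat2) * y * (c : Mat2)) =
      bil x y := by
  have hc : (c : Mat2) 0 0 * (c : Mat2) 1 1 - (c : Mat2) 0 1 * (c : Mat2) 1 0 = 1 := by
    rw [← Matrix.det_fin_two]; exact c.2
  rw [Matrix.SpecialLinearGroup.coe_inv, Matrix.adjugate_fin_two]
  have h2 : bil (!![(c : Mat2) 1 1, -(c : Mat2) 0 1; -(c : Mat2) 1 0, (c : Mat2) 0 0] * x * (c : Mat2))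
      (!![(c : Mat2) 1 1, -(c : Mat2) 0 1; -(c : Mat2) 1 0, (c : Mat2) 0 0] * y * (c : Mat2)) =
      ((c : Mat2) 0 0 * (c : Mat2) 1 1 - (c : Mat2) 0 1 * (c : Mat2) 1 0) ^ 2 * bil x y := by
    simp only [bil, Matrix.mul_apply, Fin.sum_univ_two, Matrix.of_apply, Matrix.cons_val', Matrix.cons_val_zero,
      Matrix.cons_val_one, Matrix.cons_val_fin_one]
    ring
  rw [h2, hc]; ring

theorem metric_congruence (a b c : SL2) (p : SL2 × SL2) (Z W : Mat2 × Mat2) :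
    metric (congruence a b c p)
      ((a : Mat2) * Z.1 * (c : Mat2), (b : Mat2) * Z.2 * (c : Mat2))
      ((a : Mat2) * W.1 * (c : Mat2), (b : Mat2) * W.2 * (c : Mat2)) = metric p Z W := by
  simp only [metric, leftTriv_congruence, algMetric, bil_conj]

theorem almostComplex_congruence (a b c : SL2) (p : SL2 × SL2) (Z : Mat2 × Mat2) :
    almostComplex (congruence a b c p)
      ((a : Mat2) * Z.1 * (c : Mat2), (b : Mat2) * Z.2 * (c : Mat2)) =
      ((a : Mat2) * (almostComplex p Z).1 * (c : Mat2),
       (b : Mat2) * (almostComplex p Z).2 * (c : Mat2)) := by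
  have hc : (c : Mat2) * ((c⁻¹ : SL2) : Mat2) = 1 := by
    rw [← Matrix.SpecialLinearGroup.coe_mul, mul_inv_cancel, Matrix.SpecialLinearGroup.coe_one]
  have key : ∀ (q : SL2) (U : Mat2),
      (q : Mat2) * ((c : Mat2) * (((c⁻¹ : SL2) : Mat2) * U)) = (q : Mat2) * U := by
    intro q U
    rw [← Matrix.mul_assoc (c : Mat2), hc, Matrix.one_mul]
  simp only [almostComplex, leftTriv_congruence, leftTranslate, algJ]
  refine Prod.ext ?_ ?_ <;>
  simp only [congruence, Matrix.SpecialLinearGroup.coe_mul, Matrix.mul_smul, Matrix.smul_mul,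
    Matrix.mul_sub, Matrix.sub_mul, Matrix.mul_assoc, key]

/-! ### Curvature of a metric in coordinates -/

/-- The partial derivative with respect to the `i`-th coordinate of the plane. -/
noncomputable def coordDeriv (i : Fin 2) (f : Plane → ℝ) (u : Plane) : ℝ :=
  fderiv ℝ f u (EuclideanSpace.single i (1 : ℝ))

/-- The Christoffel symbol `Γ^k_{ij}` of the metric with coefficients `h`. -/
noncomputable def christoffel (h : Plane → Matrix (Fin 2) (Fin 2) ℝ) (k i j : Fin 2) (u : Plane) :
    ℝ :=
  1 / 2 * ∑ l, (h u)⁻¹ k l *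
    (coordDeriv i (fun w => h w j l) u + coordDeriv j (fun w => h w i l) u
      - coordDeriv l (fun w => h w i j) u)

/-- The components of the curvature tensor: `R(∂_i, ∂_j) ∂_k = ∑ l, riemann h l k i j • ∂_l`, where
`R(X, Y) = [∇_X, ∇_Y] - ∇_{[X, Y]}`. -/
noncomputable def riemann (h : Plane → Matrix (Fin 2) (Fin 2) ℝ) (l k i j : Fin 2) (u : Plane) :
    ℝ :=
  coordDeriv i (christoffel h l j k) u - coordDeriv j (christoffel h l i k) u
    + ∑ m, (christoffel h l i m u * christoffel h m j k u
      - christoffel h l j m u * christoffel h m i k u)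

/-- The Gaussian curvature `g(R(∂_0, ∂_1) ∂_1, ∂_0) / det g`. -/
noncomputable def gaussCurvature (h : Plane → Matrix (Fin 2) (Fin 2) ℝ) (u : Plane) : ℝ :=
  (∑ l, riemann h l 1 0 1 u * h u l 0) / (h u).det

/-! ### Local parametrizations of surfaces in `SL(2, ℝ) × SL(2, ℝ)` -/

/-- The `i`-th partial derivative of a map into `Mat2 × Mat2`, entry by entry. -/
noncomputable def matDeriv (i : Fin 2) (Y : Plane → Mat2 × Mat2) (u : Plane) : Mat2 × Mat2 :=
  (Matrix.of fun a b => coordDeriv i (fun w => (Y w).1 a b) u,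
   Matrix.of fun a b => coordDeriv i (fun w => (Y w).2 a b) u)

/-- The `i`-th coordinate vector field `∂_i G` of a parametrization `G`. -/
noncomputable def velocity (G : Plane → SL2 × SL2) (i : Fin 2) (u : Plane) : Mat2 × Mat2 :=
  matDeriv i (fun w => (((G w).1 : Mat2), ((G w).2 : Mat2))) u

/-- The coefficients of the induced metric. -/
noncomputable def firstForm (G : Plane → SL2 × SL2) (u : Plane) : Matrix (Fin 2) (Fin 2) ℝ :=
  Matrix.of fun i j => metric (G u) (velocity G i u) (velocity G j u)

/-- The covariant derivative along `∂_i G` of a vector field `Y` of `SL(2, ℝ) × SL(2, ℝ)` along `G`,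
with respect to the Levi-Civita connection of `g`: the components of `Y` in a left-invariant frame
are differentiated, and the frame is differentiated by means of `algConn`. -/
noncomputable def covDeriv (G : Plane → SL2 × SL2) (i : Fin 2) (Y : Plane → Mat2 × Mat2)
    (u : Plane) : Mat2 × Mat2 :=
  leftTranslate (G u)
    (matDeriv i (fun w => leftTriv (G w) (Y w)) u
      + algConn (leftTriv (G u) (velocity G i u)) (leftTriv (G u) (Y u)))

/-- The second fundamental form `h(∂_i, ∂_j)`, by the formula of Gauss: the difference of the
covariant derivatives of `∂_j` along `∂_i` for the Levi-Civita connections of `g` and of the induced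
metric. -/
noncomputable def secondForm (G : Plane → SL2 × SL2) (i j : Fin 2) (u : Plane) : Mat2 × Mat2 :=
  covDeriv G i (velocity G j) u - ∑ k, christoffel (firstForm G) k i j u • velocity G k u

/-! ### Surfaces -/

section Surface

variable {M : Type*} [TopologicalSpace M] [ChartedSpace Plane M]

/-- The differential of `F` at `x`, entry by entry. -/
noncomputable def differential (F : M → SL2 × SL2) (x : M) (v : TangentSpace (𝓡 2) x) :
    Mat2 × Mat2 :=
  (Matrix.of fun a b => mfderiv (𝓡 2) 𝓘(ℝ, ℝ) (fun y => ((F y).1 : Mat2) a b) x v,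
   Matrix.of fun a b => mfderiv (𝓡 2) 𝓘(ℝ, ℝ) (fun y => ((F y).2 : Mat2) a b) x v)

/-- The induced metric `F^* g`. -/
noncomputable def inducedMetric (F : M → SL2 × SL2) (x : M) (v w : TangentSpace (𝓡 2) x) : ℝ :=
  metric (F x) (differential F x v) (differential F x w)

/-- `F` is a smooth immersion whose tangent planes are invariant under `J`. -/
structure IsAlmostComplexSurface (F : M → SL2 × SL2) : Prop where
  smooth : ∀ i j, ContMDiff (𝓡 2) 𝓘(ℝ, ℝ) ∞ (fun y => ((F y).1 : Mat2) i j) ∧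
    ContMDiff (𝓡 2) 𝓘(ℝ, ℝ) ∞ (fun y => ((F y).2 : Mat2) i j)
  immersion : ∀ x, Function.Injective (differential F x)
  complex : ∀ x v, ∃ w, almostComplex (F x) (differential F x v) = differential F x w

/-- The induced metric is positive definite. -/
def HasPosDefMetric (F : M → SL2 × SL2) : Prop :=
  ∀ x, ∀ v : TangentSpace (𝓡 2) x, v ≠ 0 → 0 < inducedMetric F x v v

/-- The second fundamental form vanishes. -/
def IsTotallyGeodesic (F : M → SL2 × SL2) : Prop :=
  ∀ e ∈ atlas Plane M, ∀ u ∈ e.target, ∀ i j, secondForm (fun w => F (e.symm w)) i j u = 0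

/-- The Gaussian curvature of the induced metric vanishes. -/
def IsFlat (F : M → SL2 × SL2) : Prop :=
  ∀ e ∈ atlas Plane M, ∀ u ∈ e.target,
    gaussCurvature (firstForm (fun w => F (e.symm w))) u = 0

end Surface

/-- The matrix `diag (e^x, e^{-x})`. -/
noncomputable def expDiag (x : ℝ) : SL2 :=
  ⟨!![Real.exp x, 0; 0, Real.exp (-x)], by
    rw [Matrix.det_fin_two_of, ← Real.exp_add]; simp⟩

/-- The model immersion of the plane with coordinates `(s, t) = (z 0, z 1)`. -/
noncomputable def model (z : Plane) : SL2 × SL2 :=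
  (expDiag ((√3 * z 0 - z 1) / √2), expDiag ((√3 * z 0 + z 1) / √2))

end NearlyKahlerSL2

namespace NearlyKahlerSL2

/-! ### Algebra of the connection on left-invariant fields -/

/-! Everything happens in the left trivialization, where the coordinate frame of a chart becomes a
pair `X 0`, `X 1` of maps into pairs of trace-free matrices. Vanishing of the second fundamental
form says `∂_i X_j = ∑ Γ^k_{ij} X_k - algConn X_i X_j`. Equality of mixed derivatives
(`sum_curvature_smul_eq_algCurv`) then identifies the intrinsic curvature with the ambient `R(X 0, X
1) X 1`. This vector is tangent, orthogonal to `X 1` by skewness and orthogonal to `X 0` by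
flatness, so it vanishes because the metric is definite.

The decisive point is algebraic (`cross_eq_zero_of_algCurv_eq_zero`): if `X = (α, β)` is not null
and `R(J X, X) X = 0`, then `α` and `β` commute. Hence each tangent plane is `ℝ l × ℝ l` with `⟨l,
l⟩ > 0`. On such a plane `algConn` vanishes, so the derivatives of the frame stay in the plane and
the line `ℝ l` is locally constant; connectedness makes it constant on `M`
(`exists_line_forall_differential`).

Now `l` is a multiple of `n diag (1, -1) n⁻¹` for some `n`, and each factor of `F` has its
logarithmic derivative on this line. Integration (`exists_eq_mul_expDiag_mul`) gives `F = (a expDiag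
P n⁻¹, b expDiag Q n⁻¹)` with global functions `P` and `Q`. A linear change of coordinates from `(P,
Q)` to `(s, t)` turns this into the model and the induced metric into the Euclidean one; the inverse
function theorem does the rest. -/

theorem algConn_add_left (X X' Y : Mat2 × Mat2) :
    algConn (X + X') Y = algConn X Y + algConn X' Y := by
  ext i j <;>
    simp only [algConn, cross, Prod.fst_add, Prod.snd_add, add_mul, mul_add, Matrix.add_apply,
      Matrix.sub_apply, Matrix.smul_apply, smul_eq_mul] <;> ring

theorem algConn_add_right (X Y Y' : Mat2 × Mat2) :
    algConn X (Y + Y') = algConn X Y + algConn X Y' := by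
  ext i j <;>
    simp only [algConn, cross, Prod.fst_add, Prod.snd_add, add_mul, mul_add, Matrix.add_apply,
      Matrix.sub_apply, Matrix.smul_apply, smul_eq_mul] <;> ring

theorem algConn_smul_left (c : ℝ) (X Y : Mat2 × Mat2) :
    algConn (c • X) Y = c • algConn X Y := by
  ext i j <;>
    simp only [algConn, cross, Prod.smul_fst, Prod.smul_snd, smul_mul_assoc, mul_smul_comm,
      Matrix.add_apply, Matrix.sub_apply, Matrix.smul_apply, smul_eq_mul] <;> ring

theorem algConn_smul_right (c : ℝ) (X Y : Mat2 × Mat2) :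
    algConn X (c • Y) = c • algConn X Y := by
  ext i j <;>
    simp only [algConn, cross, Prod.smul_fst, Prod.smul_snd, smul_mul_assoc, mul_smul_comm,
      Matrix.add_apply, Matrix.sub_apply, Matrix.smul_apply, smul_eq_mul] <;> ring

theorem algConn_sub_left (X X' Y : Mat2 × Mat2) :
    algConn (X - X') Y = algConn X Y - algConn X' Y := by
  rw [sub_eq_add_neg, ← neg_one_smul ℝ X', algConn_add_left, algConn_smul_left]; module

theorem algConn_sub_right (X Y Y' : Mat2 × Mat2) :
    algConn X (Y - Y') = algConn X Y - algConn X Y' := by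
  rw [sub_eq_add_neg, ← neg_one_smul ℝ Y', algConn_add_right, algConn_smul_right]; module

theorem algMetric_add_left (X X' Y : Mat2 × Mat2) :
    algMetric (X + X') Y = algMetric X Y + algMetric X' Y := by
  simp only [algMetric, bil, Prod.fst_add, Prod.snd_add, Matrix.add_apply]; ring

theorem algMetric_smul_left (c : ℝ) (X Y : Mat2 × Mat2) :
    algMetric (c • X) Y = c * algMetric X Y := by
  simp only [algMetric, bil, Prod.smul_fst, Prod.smul_snd, Matrix.smul_apply, smul_eq_mul]; ring

theorem algMetric_comm (X Y : Mat2 × Mat2) : algMetric X Y = algMetric Y X := by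
  simp only [algMetric, bil]; ring

theorem algMetric_add_right (X Y Y' : Mat2 × Mat2) :
    algMetric X (Y + Y') = algMetric X Y + algMetric X Y' := by
  rw [algMetric_comm, algMetric_add_left, algMetric_comm Y, algMetric_comm Y']

theorem algMetric_smul_right (c : ℝ) (X Y : Mat2 × Mat2) :
    algMetric X (c • Y) = c * algMetric X Y := by
  rw [algMetric_comm, algMetric_smul_left, algMetric_comm Y]

theorem algMetric_sub_left (X X' Y : Mat2 × Mat2) :
    algMetric (X - X') Y = algMetric X Y - algMetric X' Y := by
  rw [sub_eq_add_neg, ← neg_one_smul ℝ X', algMetric_add_left, algMetric_smul_left]; ring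

/-- The curvature tensor `R(X, Y) Z` of the connection `algConn` on left-invariant fields. -/
noncomputable def algCurv (X Y Z : Mat2 × Mat2) : Mat2 × Mat2 :=
  algConn X (algConn Y Z) - algConn Y (algConn X Z) - algConn (algConn X Y - algConn Y X) Z

theorem algCurv_add_left (X X' Y Z : Mat2 × Mat2) :
    algCurv (X + X') Y Z = algCurv X Y Z + algCurv X' Y Z := by
  simp only [algCurv, algConn_add_left, algConn_add_right, algConn_sub_left]; abel

theorem algCurv_smul_left (c : ℝ) (X Y Z : Mat2 × Mat2) :
    algCurv (c • X) Y Z = c • algCurv X Y Z := by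
  simp only [algCurv, algConn_smul_left, algConn_smul_right, algConn_sub_left]; module

theorem algCurv_self (X Z : Mat2 × Mat2) : algCurv X X Z = 0 := by
  rw [algCurv, sub_self, sub_self, ← zero_smul ℝ X, algConn_smul_left, zero_smul, zero_smul, sub_self]

theorem algMetric_algConn_self (X Y : Mat2 × Mat2) : algMetric (algConn X Y) Y = 0 := by
  have h := algConn_metric X Y Y
  rw [algMetric_comm Y] at h
  linarith

/-- Each `algConn X` is skew for the metric, hence so is the curvature operator, which is built from
commutators of such maps and one further `algConn`. -/
theorem algMetric_algCurv_self (X Y Z : Mat2 × Mat2) : algMetric (algCurv X Y Z) Z = 0 := by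
  have h1 := algConn_metric X (algConn Y Z) Z
  have h2 := algConn_metric Y (algConn X Z) Z
  have h3 := algMetric_algConn_self (algConn X Y - algConn Y X) Z
  rw [algMetric_comm (algConn Y Z)] at h1
  rw [algCurv, algMetric_sub_left, algMetric_sub_left, h3]
  linarith

theorem entries_of_trace_eq_zero {a : Mat2} (h : a.trace = 0) : a 1 1 = -a 0 0 := by
  rw [Matrix.trace_fin_two] at h; linarith

/-! ### The cross product on trace-free matrices. -/

theorem cross_add_left (a a' b : Mat2) : cross (a + a') b = cross a b + cross a' b := by
  simp only [cross, add_mul, mul_add]; module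

theorem cross_smul_left (c : ℝ) (a b : Mat2) : cross (c • a) b = c • cross a b := by
  simp only [cross, smul_mul_assoc, mul_smul_comm]; module

theorem cross_comm (a b : Mat2) : cross a b = -cross b a := by
  simp only [cross]; module

theorem cross_zero_left (a : Mat2) : cross 0 a = 0 := by
  simp [cross]

theorem cross_zero_right (a : Mat2) : cross a 0 = 0 := by
  simp [cross]

theorem cross_self (a : Mat2) : cross a a = 0 := by
  simp [cross]

theorem cross_sub_left (a a' b : Mat2) : cross (a - a') b = cross a b - cross a' b := by
  simp only [cross, sub_mul, mul_sub]; module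

theorem cross_neg_left (a b : Mat2) : cross (-a) b = -cross a b := by
  simp only [cross, neg_mul, mul_neg]; module

theorem cross_add_right (a b b' : Mat2) : cross a (b + b') = cross a b + cross a b' := by
  simp only [cross, add_mul, mul_add]; module

theorem cross_sub_right (a b b' : Mat2) : cross a (b - b') = cross a b - cross a b' := by
  simp only [cross, sub_mul, mul_sub]; module

theorem cross_smul_right (c : ℝ) (a b : Mat2) : cross a (c • b) = c • cross a b := by
  simp only [cross, smul_mul_assoc, mul_smul_comm]; module

theorem cross_neg_right (a b : Mat2) : cross a (-b) = -cross a b := by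
  simp only [cross, neg_mul, mul_neg]; module

/-- The double vector product identity of Lorentzian 3-space; its sign is opposite to the Euclidean
one. It reduces curvature on a plane spanned by `(α, β)` and its image under `J` to combinations of
`α` and `β`. -/
theorem cross_cross {a b c : Mat2} (ha : a.trace = 0) (hb : b.trace = 0) (hc : c.trace = 0) :
    cross a (cross b c) = bil a b • c - bil a c • b := by
  have e1 := entries_of_trace_eq_zero ha
  have e2 := entries_of_trace_eq_zero hb
  have e3 := entries_of_trace_eq_zero hc
  ext i j
  fin_cases i <;> fin_cases j <;>
  · simp only [cross, bil, Matrix.sub_apply, Matrix.smul_apply, smul_eq_mul, Matrix.mul_apply,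
      Fin.sum_univ_two, Fin.zero_eta, Fin.mk_one, Fin.isValue, e1, e2, e3]
    ring

theorem bil_comm (a b : Mat2) : bil a b = bil b a := by
  simp only [bil]; ring

/-- On a `J`-invariant plane spanned by `X = (α, β)` and `J X`, vanishing of the curvature
`R(J X, X) X` forces `α` and `β` to be proportional, unless `X` is null. -/
theorem cross_eq_zero_of_algCurv_eq_zero {X : Mat2 × Mat2} (h1 : X.1.trace = 0)
    (h2 : X.2.trace = 0) (hX : algMetric X X ≠ 0) (hR : algCurv (√3 • algJ X) X X = 0) :
    cross X.1 X.2 = 0 := by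
  -- The factor `√3` clears the denominator of `J`, so that the computation below has rational
  -- coefficients.
  have hJ : √3 • algJ X = (X.1 - (2 : ℝ) • X.2, (2 : ℝ) • X.1 - X.2) := by
    have h3 : √3 * (1 / √3) = 1 := mul_one_div_cancel (by positivity)
    simp only [algJ, Prod.smul_mk, smul_smul, h3, one_smul]
  obtain ⟨α, β⟩ := X
  simp only at h1 h2 hJ ⊢
  -- Both components of the curvature vector are combinations of `α` and `β`, and crossing with `α`
  -- or `β` reads off a coefficient. This combination of the four coefficients collapses to a
  -- multiple of `g(X, X)`.
  have key : (2 : ℝ) • (cross α (algCurv (α - (2 : ℝ) • β, (2 : ℝ) • α - β) (α, β) (α, β)).1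
        - cross (algCurv (α - (2 : ℝ) • β, (2 : ℝ) • α - β) (α, β) (α, β)).2 β)
      + (cross (algCurv (α - (2 : ℝ) • β, (2 : ℝ) • α - β) (α, β) (α, β)).1 β
        - cross α (algCurv (α - (2 : ℝ) • β, (2 : ℝ) • α - β) (α, β) (α, β)).2)
      = (8 * algMetric (α, β) (α, β)) • cross α β := by
    have hαγ : cross α (cross α β) = bil α α • β - bil α β • α := cross_cross h1 h1 h2
    have hβγ : cross β (cross α β) = bil α β • β - bil β β • α := by
      rw [cross_cross h2 h1 h2, bil_comm β α]
    have hβα : cross β α = -cross α β := cross_comm β α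
    have hγα : cross (cross α β) α = -(bil α α • β - bil α β • α) := by rw [cross_comm, hαγ]
    have hγβ : cross (cross α β) β = -(bil α β • β - bil β β • α) := by rw [cross_comm, hβγ]
    simp only [algCurv, algConn, algMetric, cross_add_left, cross_add_right, cross_sub_left,
      cross_sub_right, cross_smul_left, cross_smul_right, cross_neg_left, cross_neg_right,
      cross_self, cross_zero_left, cross_zero_right, hβα, hαγ, hβγ, hγα, hγβ, Prod.fst_sub,
      Prod.snd_sub, bil_comm β α]
    module
  rw [hJ] at hR
  rw [hR] at key
  rw [Prod.fst_zero, Prod.snd_zero, cross_zero_right, cross_zero_left, sub_zero, smul_zero, add_zero] at key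
  exact (smul_eq_zero.1 key.symm).resolve_left (by simpa using hX)

/-- Commuting trace-free matrices have proportional entries. -/
theorem mul_comm_entries_of_cross_eq_zero {a b : Mat2} (ha : a.trace = 0) (hb : b.trace = 0)
    (h : cross a b = 0) (i j k l : Fin 2) : a i j * b k l = a k l * b i j := by
  have e1 := entries_of_trace_eq_zero ha
  have e2 := entries_of_trace_eq_zero hb
  have h00 := congrFun (congrFun h 0) 0
  have h01 := congrFun (congrFun h 0) 1
  have h10 := congrFun (congrFun h 1) 0
  simp only [cross, Matrix.sub_apply, Matrix.smul_apply, smul_eq_mul, Matrix.mul_apply,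
    Fin.sum_univ_two, Matrix.zero_apply, e1, e2] at h00 h01 h10
  fin_cases i <;> fin_cases j <;> fin_cases k <;> fin_cases l <;>
    simp only [Fin.zero_eta, Fin.mk_one, Fin.isValue, e1, e2] <;> linarith

/-! ### Partial derivatives of matrix-valued maps -/

theorem coordDeriv_const (i : Fin 2) (c : ℝ) (u : Plane) : coordDeriv i (fun _ => c) u = 0 := by
  simp [coordDeriv]

theorem coordDeriv_add {i : Fin 2} {f g : Plane → ℝ} {u : Plane} (hf : DifferentiableAt ℝ f u)
    (hg : DifferentiableAt ℝ g u) :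
    coordDeriv i (fun w => f w + g w) u = coordDeriv i f u + coordDeriv i g u := by
  simp only [coordDeriv, fderiv_fun_add hf hg, add_apply]

theorem coordDeriv_sub {i : Fin 2} {f g : Plane → ℝ} {u : Plane} (hf : DifferentiableAt ℝ f u)
    (hg : DifferentiableAt ℝ g u) :
    coordDeriv i (fun w => f w - g w) u = coordDeriv i f u - coordDeriv i g u := by
  simp only [coordDeriv, fderiv_fun_sub hf hg, sub_apply]

theorem coordDeriv_mul {i : Fin 2} {f g : Plane → ℝ} {u : Plane} (hf : DifferentiableAt ℝ f u)
    (hg : DifferentiableAt ℝ g u) :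
    coordDeriv i (fun w => f w * g w) u = coordDeriv i f u * g u + f u * coordDeriv i g u := by
  simp only [coordDeriv, fderiv_fun_mul hf hg, add_apply,
    smul_apply, smul_eq_mul]
  ring

theorem coordDeriv_congr {i : Fin 2} {f g : Plane → ℝ} {u : Plane}
    (h : f =ᶠ[nhds u] g) : coordDeriv i f u = coordDeriv i g u := by
  rw [coordDeriv, coordDeriv, h.fderiv_eq]

theorem contDiffOn_coordDeriv {i : Fin 2} {f : Plane → ℝ} {U : Set Plane} (hU : IsOpen U)
    (hf : ContDiffOn ℝ ∞ f U) : ContDiffOn ℝ ∞ (coordDeriv i f) U :=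
  (hf.fderiv_of_isOpen hU (m := ∞) (by simp)).clm_apply contDiffOn_const

theorem coordDeriv_comm {f : Plane → ℝ} {U : Set Plane} (hU : IsOpen U)
    (hf : ContDiffOn ℝ ∞ f U) {u : Plane} (hu : u ∈ U) (i j : Fin 2) :
    coordDeriv i (coordDeriv j f) u = coordDeriv j (coordDeriv i f) u := by
  have hd : DifferentiableAt ℝ (fderiv ℝ f) u :=
    ((hf.fderiv_of_isOpen hU (m := ∞) (by simp)).contDiffAt (hU.mem_nhds hu)).differentiableAt
      (by simp)
  have hs : IsSymmSndFDerivAt ℝ f u :=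
    (hf.contDiffAt (hU.mem_nhds hu)).isSymmSndFDerivAt
      (by simpa using WithTop.coe_le_coe.2 (le_top : (2 : ℕ∞) ≤ ⊤))
  have h : ∀ i j : Fin 2, coordDeriv i (coordDeriv j f) u =
      fderiv ℝ (fderiv ℝ f) u (EuclideanSpace.single i 1) (EuclideanSpace.single j 1) := by
    intro i j
    change fderiv ℝ (fun w => fderiv ℝ f w (EuclideanSpace.single j 1)) u _ = _
    rw [fderiv_clm_apply hd (differentiableAt_const _)]
    simp
  rw [h, h]
  exact hs _ _

/-- Differentiability of all entries of a pair of matrices. -/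
def EntriesDifferentiableAt (Y : Plane → Mat2 × Mat2) (u : Plane) : Prop :=
  (∀ a b, DifferentiableAt ℝ (fun w => (Y w).1 a b) u) ∧
    ∀ a b, DifferentiableAt ℝ (fun w => (Y w).2 a b) u

/-- Smoothness of all entries of a pair of matrices. -/
def SmoothEntriesOn (Y : Plane → Mat2 × Mat2) (U : Set Plane) : Prop :=
  (∀ a b, ContDiffOn ℝ ∞ (fun w => (Y w).1 a b) U) ∧
    ∀ a b, ContDiffOn ℝ ∞ (fun w => (Y w).2 a b) U

theorem SmoothEntriesOn.differentiableAt {Y : Plane → Mat2 × Mat2} {U : Set Plane}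
    (hY : SmoothEntriesOn Y U) (hU : IsOpen U) {u : Plane} (hu : u ∈ U) :
    EntriesDifferentiableAt Y u :=
  ⟨fun a b => ((hY.1 a b).contDiffAt (hU.mem_nhds hu)).differentiableAt (by simp),
   fun a b => ((hY.2 a b).contDiffAt (hU.mem_nhds hu)).differentiableAt (by simp)⟩

theorem SmoothEntriesOn.matDeriv {Y : Plane → Mat2 × Mat2} {U : Set Plane}
    (hY : SmoothEntriesOn Y U) (hU : IsOpen U) (i : Fin 2) : SmoothEntriesOn (matDeriv i Y) U :=
  ⟨fun a b => contDiffOn_coordDeriv hU (hY.1 a b), fun a b => contDiffOn_coordDeriv hU (hY.2 a b)⟩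

theorem matDeriv_comm {Y : Plane → Mat2 × Mat2} {U : Set Plane} (hY : SmoothEntriesOn Y U)
    (hU : IsOpen U) {u : Plane} (hu : u ∈ U) (i j : Fin 2) :
    matDeriv i (matDeriv j Y) u = matDeriv j (matDeriv i Y) u :=
  Prod.ext (Matrix.ext fun a b => coordDeriv_comm hU (hY.1 a b) hu i j)
    (Matrix.ext fun a b => coordDeriv_comm hU (hY.2 a b) hu i j)

theorem matDeriv_congr {i : Fin 2} {Y Z : Plane → Mat2 × Mat2} {u : Plane}
    (h : Y =ᶠ[nhds u] Z) : matDeriv i Y u = matDeriv i Z u :=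
  Prod.ext (Matrix.ext fun a b => coordDeriv_congr (h.fun_comp fun X => X.1 a b))
    (Matrix.ext fun a b => coordDeriv_congr (h.fun_comp fun X => X.2 a b))

/-- `f` is differentiable at `u`, with `i`-th partial derivative `f'`. -/
def HasCoordDeriv (i : Fin 2) (f : Plane → ℝ) (f' : ℝ) (u : Plane) : Prop :=
  DifferentiableAt ℝ f u ∧ coordDeriv i f u = f'

theorem HasCoordDeriv.add {i : Fin 2} {f g : Plane → ℝ} {f' g' : ℝ} {u : Plane}
    (hf : HasCoordDeriv i f f' u) (hg : HasCoordDeriv i g g' u) :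
    HasCoordDeriv i (fun w => f w + g w) (f' + g') u :=
  ⟨hf.1.add hg.1, by rw [coordDeriv_add hf.1 hg.1, hf.2, hg.2]⟩

theorem HasCoordDeriv.sub {i : Fin 2} {f g : Plane → ℝ} {f' g' : ℝ} {u : Plane}
    (hf : HasCoordDeriv i f f' u) (hg : HasCoordDeriv i g g' u) :
    HasCoordDeriv i (fun w => f w - g w) (f' - g') u :=
  ⟨hf.1.sub hg.1, by rw [coordDeriv_sub hf.1 hg.1, hf.2, hg.2]⟩

theorem HasCoordDeriv.mul {i : Fin 2} {f g : Plane → ℝ} {f' g' : ℝ} {u : Plane}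
    (hf : HasCoordDeriv i f f' u) (hg : HasCoordDeriv i g g' u) :
    HasCoordDeriv i (fun w => f w * g w) (f' * g u + f u * g') u :=
  ⟨hf.1.mul hg.1, by rw [coordDeriv_mul hf.1 hg.1, hf.2, hg.2]⟩

theorem HasCoordDeriv.const_mul {i : Fin 2} {f : Plane → ℝ} {f' : ℝ} {u : Plane}
    (hf : HasCoordDeriv i f f' u) (c : ℝ) : HasCoordDeriv i (fun w => c * f w) (c * f') u :=
  ⟨hf.1.const_mul c, by
    rw [coordDeriv_mul (differentiableAt_const c) hf.1, hf.2, coordDeriv_const]; ring⟩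

theorem HasCoordDeriv.mul_matrix {i : Fin 2} {A B : Plane → Mat2} {A' B' : Mat2} {u : Plane}
    (hA : ∀ a b, HasCoordDeriv i (fun w => A w a b) (A' a b) u)
    (hB : ∀ a b, HasCoordDeriv i (fun w => B w a b) (B' a b) u) (a b : Fin 2) :
    HasCoordDeriv i (fun w => (A w * B w) a b) ((A' * B u + A u * B') a b) u := by
  convert ((hA a 0).mul (hB 0 b)).add ((hA a 1).mul (hB 1 b)) using 1
  · funext w; rw [Matrix.mul_apply, Fin.sum_univ_two]
  · rw [Matrix.add_apply, Matrix.mul_apply, Matrix.mul_apply, Fin.sum_univ_two, Fin.sum_univ_two]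
    ring

theorem HasCoordDeriv.cross {i : Fin 2} {A B : Plane → Mat2} {A' B' : Mat2} {u : Plane}
    (hA : ∀ a b, HasCoordDeriv i (fun w => A w a b) (A' a b) u)
    (hB : ∀ a b, HasCoordDeriv i (fun w => B w a b) (B' a b) u) (a b : Fin 2) :
    HasCoordDeriv i (fun w => cross (A w) (B w) a b) ((cross A' (B u) + cross (A u) B') a b) u := by
  convert ((mul_matrix hA hB a b).sub (mul_matrix hB hA a b)).const_mul (1 / 2) using 1
  · simp only [NearlyKahlerSL2.cross, Matrix.sub_apply, Matrix.smul_apply,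
    smul_eq_mul]
  · simp only [NearlyKahlerSL2.cross, Matrix.add_apply, Matrix.sub_apply, Matrix.smul_apply,
    smul_eq_mul]
    ring

/-- The entries of `Y` are differentiable at `u`, with `i`-th partial derivatives given by `Y'`. -/
def HasMatDeriv (i : Fin 2) (Y : Plane → Mat2 × Mat2) (Y' : Mat2 × Mat2) (u : Plane) : Prop :=
  (∀ a b, HasCoordDeriv i (fun w => (Y w).1 a b) (Y'.1 a b) u) ∧
    ∀ a b, HasCoordDeriv i (fun w => (Y w).2 a b) (Y'.2 a b) u

theorem EntriesDifferentiableAt.hasMatDeriv {Y : Plane → Mat2 × Mat2} {u : Plane}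
    (hY : EntriesDifferentiableAt Y u) (i : Fin 2) : HasMatDeriv i Y (matDeriv i Y u) u :=
  ⟨fun a b => ⟨hY.1 a b, rfl⟩, fun a b => ⟨hY.2 a b, rfl⟩⟩

theorem HasMatDeriv.matDeriv_eq {i : Fin 2} {Y : Plane → Mat2 × Mat2} {Y' : Mat2 × Mat2}
    {u : Plane} (h : HasMatDeriv i Y Y' u) : matDeriv i Y u = Y' :=
  Prod.ext (Matrix.ext fun a b => (h.1 a b).2) (Matrix.ext fun a b => (h.2 a b).2)

theorem HasMatDeriv.algConn {i : Fin 2} {Y Z : Plane → Mat2 × Mat2} {Y' Z' : Mat2 × Mat2}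
    {u : Plane} (hY : HasMatDeriv i Y Y' u) (hZ : HasMatDeriv i Z Z' u) :
    HasMatDeriv i (fun w => algConn (Y w) (Z w)) (algConn Y' (Z u) + algConn (Y u) Z') u := by
  constructor <;> intro a b
  · convert (((HasCoordDeriv.cross hY.1 hZ.1 a b).sub
      ((HasCoordDeriv.cross hY.1 hZ.2 a b).const_mul (1 / 3))).add
      ((HasCoordDeriv.cross hY.2 hZ.1 a b).const_mul (1 / 3))) using 1
    · simp only [NearlyKahlerSL2.algConn, Matrix.add_apply, Matrix.sub_apply,
      Matrix.smul_apply, smul_eq_mul]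
    · simp only [NearlyKahlerSL2.algConn, Prod.fst_add, Matrix.add_apply, Matrix.sub_apply,
      Matrix.smul_apply, smul_eq_mul]
      ring
  · convert (((HasCoordDeriv.cross hY.2 hZ.2 a b).add
      ((HasCoordDeriv.cross hY.1 hZ.2 a b).const_mul (1 / 3))).sub
      ((HasCoordDeriv.cross hY.2 hZ.1 a b).const_mul (1 / 3))) using 1
    · simp only [NearlyKahlerSL2.algConn, Matrix.add_apply, Matrix.sub_apply,
      Matrix.smul_apply, smul_eq_mul]
    · simp only [NearlyKahlerSL2.algConn, Prod.snd_add, Matrix.add_apply, Matrix.sub_apply,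
      Matrix.smul_apply, smul_eq_mul]
      ring

theorem HasMatDeriv.add {i : Fin 2} {Y Z : Plane → Mat2 × Mat2} {Y' Z' : Mat2 × Mat2}
    {u : Plane} (hY : HasMatDeriv i Y Y' u) (hZ : HasMatDeriv i Z Z' u) :
    HasMatDeriv i (fun w => Y w + Z w) (Y' + Z') u :=
  ⟨fun a b => (hY.1 a b).add (hZ.1 a b), fun a b => (hY.2 a b).add (hZ.2 a b)⟩

theorem HasMatDeriv.sub {i : Fin 2} {Y Z : Plane → Mat2 × Mat2} {Y' Z' : Mat2 × Mat2}
    {u : Plane} (hY : HasMatDeriv i Y Y' u) (hZ : HasMatDeriv i Z Z' u) :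
    HasMatDeriv i (fun w => Y w - Z w) (Y' - Z') u :=
  ⟨fun a b => (hY.1 a b).sub (hZ.1 a b), fun a b => (hY.2 a b).sub (hZ.2 a b)⟩

theorem HasMatDeriv.smul {i : Fin 2} {f : Plane → ℝ} {Y : Plane → Mat2 × Mat2} {Y' : Mat2 × Mat2}
    {u : Plane} (hf : DifferentiableAt ℝ f u) (hY : HasMatDeriv i Y Y' u) :
    HasMatDeriv i (fun w => f w • Y w) (coordDeriv i f u • Y u + f u • Y') u :=
  have hf' : HasCoordDeriv i f (coordDeriv i f u) u := ⟨hf, rfl⟩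
  ⟨fun a b => hf'.mul (hY.1 a b), fun a b => hf'.mul (hY.2 a b)⟩

/-! ### Local theory of totally geodesic surfaces -/

/-- If a frame `X` of a surface satisfies the equations `∇_i X_j = ∑ Γ^k_{ij} X_k` of a totally
geodesic surface, then the curvature of the coefficients `Γ` is that of the ambient space. -/
theorem sum_curvature_smul_eq_algCurv {U : Set Plane} (hU : IsOpen U)
    {X : Fin 2 → Plane → Mat2 × Mat2} {Γ : Fin 2 → Fin 2 → Fin 2 → Plane → ℝ}
    (hX : ∀ i, SmoothEntriesOn (X i) U)
    (hΓ : ∀ k i j, ∀ u ∈ U, DifferentiableAt ℝ (Γ k i j) u)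
    (hsymm : ∀ k i j u, Γ k i j u = Γ k j i u)
    (heq : ∀ i j, ∀ u ∈ U,
      matDeriv i (X j) u = ∑ k, Γ k i j u • X k u - algConn (X i u) (X j u))
    {u : Plane} (hu : u ∈ U) :
    ∑ l, (coordDeriv 0 (Γ l 1 1) u - coordDeriv 1 (Γ l 0 1) u
      + ∑ m, (Γ l 0 m u * Γ m 1 1 u - Γ l 1 m u * Γ m 0 1 u)) • X l u
      = algCurv (X 0 u) (X 1 u) (X 1 u) := by
  have hder : ∀ i j, HasMatDeriv i (X j) (matDeriv i (X j) u) u := fun i j =>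
    ((hX j).differentiableAt hU hu).hasMatDeriv i
  have hsecond : ∀ i j, matDeriv i (matDeriv j (X 1)) u =
      ((coordDeriv i (Γ 0 j 1) u • X 0 u + Γ 0 j 1 u • matDeriv i (X 0) u) +
      (coordDeriv i (Γ 1 j 1) u • X 1 u + Γ 1 j 1 u • matDeriv i (X 1) u)) -
      (algConn (matDeriv i (X j) u) (X 1 u) + algConn (X j u) (matDeriv i (X 1) u)) := by
    intro i j
    have hev : matDeriv j (X 1) =ᶠ[nhds u]
        fun w => (Γ 0 j 1 w • X 0 w + Γ 1 j 1 w • X 1 w) - algConn (X j w) (X 1 w) := by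
      filter_upwards [hU.mem_nhds hu] with w hw
      rw [heq j 1 w hw, Fin.sum_univ_two]
    rw [matDeriv_congr hev]
    exact ((((hder i 0).smul (hΓ 0 j 1 u hu)).add ((hder i 1).smul (hΓ 1 j 1 u hu))).sub
      ((hder i j).algConn (hder i 1))).matDeriv_eq
  -- After the first derivatives are eliminated by `heq`, the terms mixing `Γ` with `algConn`
  -- cancel. By symmetry of `Γ`, `∂_0 X_1 - ∂_1 X_0` is minus the bracket, which supplies the third
  -- term of `algCurv`.
  have hcomm := matDeriv_comm (hX 1) hU hu 0 1
  rw [hsecond, hsecond, heq 0 1 u hu, heq 1 1 u hu, heq 1 0 u hu, heq 0 0 u hu] at hcomm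
  simp only [Fin.sum_univ_two, algConn_add_left, algConn_add_right, algConn_sub_left,
    algConn_sub_right, algConn_smul_left, algConn_smul_right, hsymm _ 1 0] at hcomm
  simp only [algCurv, Fin.sum_univ_two, algConn_sub_left, hsymm _ 1 0]
  rw [← sub_eq_zero] at hcomm ⊢
  rw [← hcomm]
  module

/-- The coordinate frame `∂_i G` in the left trivialization. -/
noncomputable def frame (G : Plane → SL2 × SL2) (i : Fin 2) (u : Plane) : Mat2 × Mat2 :=
  leftTriv (G u) (velocity G i u)

theorem firstForm_apply (G : Plane → SL2 × SL2) (u : Plane) (i j : Fin 2) :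
    firstForm G u i j = algMetric (frame G i u) (frame G j u) := rfl

theorem christoffel_firstForm_symm (G : Plane → SL2 × SL2) (k i j : Fin 2) (u : Plane) :
    christoffel (firstForm G) k i j u = christoffel (firstForm G) k j i u := by
  simp only [christoffel, firstForm_apply]
  congr 1
  refine Finset.sum_congr rfl fun l _ => ?_
  congr 1
  rw [show (fun w => algMetric (frame G i w) (frame G j w)) =
    fun w => algMetric (frame G j w) (frame G i w) from funext fun w => algMetric_comm _ _]
  ring

theorem leftTriv_leftTranslate (p : SL2 × SL2) (X : Mat2 × Mat2) :
    leftTriv p (leftTranslate p X) = X := by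
  have h : ∀ a : SL2, ((a⁻¹ : SL2) : Mat2) * (a : Mat2) = 1 := fun a => by
    rw [← Matrix.SpecialLinearGroup.coe_mul, inv_mul_cancel, Matrix.SpecialLinearGroup.coe_one]
  simp only [leftTriv, leftTranslate, ← Matrix.mul_assoc, h, Matrix.one_mul]

theorem leftTranslate_leftTriv (p : SL2 × SL2) (Z : Mat2 × Mat2) :
    leftTranslate p (leftTriv p Z) = Z := by
  have h : ∀ a : SL2, (a : Mat2) * ((a⁻¹ : SL2) : Mat2) = 1 := fun a => by
    rw [← Matrix.SpecialLinearGroup.coe_mul, mul_inv_cancel, Matrix.SpecialLinearGroup.coe_one]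
  simp only [leftTriv, leftTranslate, ← Matrix.mul_assoc, h, Matrix.one_mul]

theorem leftTriv_add (p : SL2 × SL2) (Z W : Mat2 × Mat2) :
    leftTriv p (Z + W) = leftTriv p Z + leftTriv p W := by
  simp [leftTriv, Matrix.mul_add]

theorem leftTriv_smul (p : SL2 × SL2) (c : ℝ) (Z : Mat2 × Mat2) :
    leftTriv p (c • Z) = c • leftTriv p Z := by
  simp [leftTriv]

theorem matDeriv_frame_of_secondForm_eq_zero {G : Plane → SL2 × SL2} {i j : Fin 2} {u : Plane}
    (h : secondForm G i j u = 0) :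
    matDeriv i (frame G j) u =
      ∑ k, christoffel (firstForm G) k i j u • frame G k u
        - algConn (frame G i u) (frame G j u) := by
  have h' := congrArg (leftTriv (G u)) (sub_eq_zero.1 h)
  rw [covDeriv, leftTriv_leftTranslate, Fin.sum_univ_two, leftTriv_add, leftTriv_smul,
    leftTriv_smul] at h'
  rw [Fin.sum_univ_two, eq_sub_iff_add_eq]
  exact h'

theorem coe_inv_fin_two (a : SL2) : ((a⁻¹ : SL2) : Mat2) =
    !![(a : Mat2) 1 1, -(a : Mat2) 0 1; -(a : Mat2) 1 0, (a : Mat2) 0 0] := by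
  rw [Matrix.SpecialLinearGroup.coe_inv, Matrix.adjugate_fin_two]

theorem contDiffOn_inv_mul_entry {A : Plane → SL2} {B : Plane → Mat2} {U : Set Plane}
    (hA : ∀ a b, ContDiffOn ℝ ∞ (fun w => (A w : Mat2) a b) U)
    (hB : ∀ a b, ContDiffOn ℝ ∞ (fun w => B w a b) U) (a b : Fin 2) :
    ContDiffOn ℝ ∞ (fun w => ((((A w)⁻¹ : SL2) : Mat2) * B w) a b) U := by
  simp only [coe_inv_fin_two, Matrix.mul_apply, Fin.sum_univ_two]
  fin_cases a <;> simp only [Fin.zero_eta, Fin.mk_one, Fin.isValue, Matrix.of_apply,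
    Matrix.cons_val', Matrix.cons_val_zero, Matrix.cons_val_one, Matrix.cons_val_fin_one]
  · exact ((hA 1 1).mul (hB 0 b)).add ((hA 0 1).neg.mul (hB 1 b))
  · exact ((hA 1 0).neg.mul (hB 0 b)).add ((hA 0 0).mul (hB 1 b))

theorem smoothEntriesOn_frame {G : Plane → SL2 × SL2} {U : Set Plane} (hU : IsOpen U)
    (hG : SmoothEntriesOn (fun w => (((G w).1 : Mat2), ((G w).2 : Mat2))) U) (i : Fin 2) :
    SmoothEntriesOn (frame G i) U :=
  ⟨contDiffOn_inv_mul_entry hG.1 (hG.matDeriv hU i).1,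
    contDiffOn_inv_mul_entry hG.2 (hG.matDeriv hU i).2⟩

/-- Jacobi's formula: this trace is the derivative of the determinant, which is constantly `1`. -/
theorem trace_inv_mul_coordDeriv {A : Plane → SL2} {u : Plane}
    (hA : ∀ a b, DifferentiableAt ℝ (fun w => (A w : Mat2) a b) u) (i : Fin 2) :
    ((((A u)⁻¹ : SL2) : Mat2) *
      Matrix.of fun a b => coordDeriv i (fun w => (A w : Mat2) a b) u).trace = 0 := by
  have hdet : (fun w => (A w : Mat2) 0 0 * (A w : Mat2) 1 1 - (A w : Mat2) 0 1 * (A w : Mat2) 1 0)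
      = fun _ => (1 : ℝ) := funext fun w => by rw [← Matrix.det_fin_two]; exact (A w).2
  have hA' : ∀ a b, HasCoordDeriv i (fun w => (A w : Mat2) a b)
      (coordDeriv i (fun w => (A w : Mat2) a b) u) u := fun a b => ⟨hA a b, rfl⟩
  have h := (((hA' 0 0).mul (hA' 1 1)).sub ((hA' 0 1).mul (hA' 1 0))).2
  rw [hdet, coordDeriv_const] at h
  rw [Matrix.trace_fin_two, coe_inv_fin_two]
  simp only [Matrix.mul_apply, Fin.sum_univ_two, Matrix.of_apply,
    Matrix.cons_val', Matrix.cons_val_zero, Matrix.cons_val_one, Matrix.cons_val_fin_one]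
  linarith

theorem trace_frame {G : Plane → SL2 × SL2} {u : Plane}
    (hG : EntriesDifferentiableAt (fun w => (((G w).1 : Mat2), ((G w).2 : Mat2))) u) (i : Fin 2) :
    (frame G i u).1.trace = 0 ∧ (frame G i u).2.trace = 0 :=
  ⟨trace_inv_mul_coordDeriv hG.1 i, trace_inv_mul_coordDeriv hG.2 i⟩

theorem contDiffOn_firstForm {G : Plane → SL2 × SL2} {U : Set Plane} (hU : IsOpen U)
    (hG : SmoothEntriesOn (fun w => (((G w).1 : Mat2), ((G w).2 : Mat2))) U) (i j : Fin 2) :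
    ContDiffOn ℝ ∞ (fun w => firstForm G w i j) U := by
  have hbil : ∀ A B : Plane → Mat2, (∀ a b, ContDiffOn ℝ ∞ (fun w => A w a b) U) →
      (∀ a b, ContDiffOn ℝ ∞ (fun w => B w a b) U) →
      ContDiffOn ℝ ∞ (fun w => bil (A w) (B w)) U := fun A B hA hB =>
    contDiffOn_const.mul (((((hA 0 0).mul (hB 1 1)).sub ((hA 0 1).mul (hB 1 0))).sub
      ((hA 1 0).mul (hB 0 1))).add ((hA 1 1).mul (hB 0 0)))
  have hi := smoothEntriesOn_frame hU hG i
  have hj := smoothEntriesOn_frame hU hG j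
  exact (contDiffOn_const.mul ((hbil _ _ hi.1 hj.1).add (hbil _ _ hi.2 hj.2))).sub
    (contDiffOn_const.mul ((hbil _ _ hi.2 hj.1).add (hbil _ _ hi.1 hj.2)))

theorem differentiableAt_christoffel {h : Plane → Matrix (Fin 2) (Fin 2) ℝ} {U : Set Plane}
    (hU : IsOpen U) (hh : ∀ i j, ContDiffOn ℝ ∞ (fun w => h w i j) U) {u : Plane} (hu : u ∈ U)
    (hdet : (h u).det ≠ 0) (k i j : Fin 2) : DifferentiableAt ℝ (christoffel h k i j) u := by
  have hd : ∀ i j, DifferentiableAt ℝ (fun w => h w i j) u := fun i j =>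
    ((hh i j).contDiffAt (hU.mem_nhds hu)).differentiableAt (by simp)
  have hdd : ∀ l i j, DifferentiableAt ℝ (coordDeriv l fun w => h w i j) u := fun l i j =>
    ((contDiffOn_coordDeriv hU (hh i j)).contDiffAt (hU.mem_nhds hu)).differentiableAt (by simp)
  have hdetd : DifferentiableAt ℝ (fun w => (h w).det) u := by
    simp only [Matrix.det_fin_two]
    exact ((hd 0 0).mul (hd 1 1)).sub ((hd 0 1).mul (hd 1 0))
  have hadj : ∀ k l, DifferentiableAt ℝ (fun w => (h w).adjugate k l) u := by
    intro k l
    simp only [Matrix.adjugate_fin_two]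
    fin_cases k <;> fin_cases l
    exacts [hd 1 1, (hd 0 1).neg, (hd 1 0).neg, hd 0 0]
  have hinv : ∀ k l, DifferentiableAt ℝ (fun w => (h w)⁻¹ k l) u := by
    intro k l
    simp only [Matrix.inv_def, Ring.inverse_eq_inv', Matrix.smul_apply, smul_eq_mul]
    exact (hdetd.inv hdet).mul (hadj k l)
  have hterm : ∀ l, DifferentiableAt ℝ (fun w => (h w)⁻¹ k l *
      (coordDeriv i (fun w => h w j l) w + coordDeriv j (fun w => h w i l) w
        - coordDeriv l (fun w => h w i j) w)) u := fun l =>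
    (hinv k l).mul (((hdd i j l).add (hdd j i l)).sub (hdd l i j))
  unfold christoffel
  simp only [Fin.sum_univ_two]
  exact ((hterm 0).add (hterm 1)).const_mul _

/-! ### Tangent planes of the form `ℝ l × ℝ l`. -/

theorem algJ_algJ (X : Mat2 × Mat2) : algJ (algJ X) = -X := by
  have h : (1 / √3) * (1 / √3) = 1 / 3 := by
    rw [div_mul_div_comm, Real.mul_self_sqrt (by norm_num)]; norm_num
  ext i j <;>
    simp only [algJ, Matrix.smul_apply, Matrix.sub_apply, smul_eq_mul, Prod.fst_neg, Prod.snd_neg,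
      Matrix.neg_apply]
  · linear_combination (-3 * X.1 i j) * h
  · linear_combination (-3 * X.2 i j) * h

theorem algJ_smul (c : ℝ) (X : Mat2 × Mat2) : algJ (c • X) = c • algJ X := by
  simp only [algJ, Prod.smul_fst, Prod.smul_snd, Prod.smul_mk]
  refine Prod.ext ?_ ?_ <;> module

theorem algMetric_zero_left (X : Mat2 × Mat2) : algMetric 0 X = 0 := by
  rw [← zero_smul ℝ X, algMetric_smul_left, zero_mul]

/-- Two proportional trace-free matrices lie on a common line. -/
theorem exists_line_of_cross_eq_zero {a b : Mat2} (ha : a.trace = 0) (hb : b.trace = 0)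
    (h : cross a b = 0) : ∃ l : Mat2, l.trace = 0 ∧ ∃ p q : ℝ, a = p • l ∧ b = q • l := by
  by_cases h0 : a = 0
  · exact ⟨b, hb, 0, 1, by rw [h0, zero_smul], (one_smul _ _).symm⟩
  · obtain ⟨i, j, hij⟩ : ∃ i j, a i j ≠ 0 := by
      by_contra! hcon
      exact h0 (Matrix.ext hcon)
    refine ⟨a, ha, 1, b i j / a i j, (one_smul _ _).symm, Matrix.ext fun k l => ?_⟩
    have := mul_comm_entries_of_cross_eq_zero ha hb h i j k l
    rw [Matrix.smul_apply, smul_eq_mul]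
    field_simp
    linarith

/-- Since `p ^ 2 - p * q + q ^ 2` is positive definite, the sign of the metric on `ℝ l × ℝ l` is
that of `bil l l`. -/
theorem algMetric_smul_line (l : Mat2) (p q : ℝ) :
    algMetric (p • l, q • l) (p • l, q • l) = 2 / 3 * (p ^ 2 - p * q + q ^ 2) * bil l l := by
  simp only [algMetric, bil, Matrix.smul_apply, smul_eq_mul]; ring

theorem bil_smul_smul (c : ℝ) (l : Mat2) : bil (c • l) (c • l) = c ^ 2 * bil l l := by
  simp only [bil, Matrix.smul_apply, smul_eq_mul]; ring

/-- A spacelike `J`-invariant plane of zero curvature has the form `ℝ l × ℝ l`. -/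
theorem exists_line_of_algCurv_eq_zero {X : Fin 2 → Mat2 × Mat2}
    (htr : ∀ i, (X i).1.trace = 0 ∧ (X i).2.trace = 0)
    (hpos : ∀ x y : ℝ, x ≠ 0 ∨ y ≠ 0 →
      0 < algMetric (x • X 0 + y • X 1) (x • X 0 + y • X 1))
    (hJ : ∃ x y : ℝ, algJ (X 1) = x • X 0 + y • X 1)
    (hR : algCurv (X 0) (X 1) (X 1) = 0) :
    ∃ l : Mat2, l.trace = 0 ∧ 0 < bil l l ∧ ∀ i, ∃ p q : ℝ, X i = (p • l, q • l) := by
  have hpos1 : 0 < algMetric (X 1) (X 1) := by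
    simpa using hpos 0 1 (Or.inr one_ne_zero)
  obtain ⟨x, y, hxy⟩ := hJ
  -- Otherwise `X 1` would be a real eigenvector of `J`, and `J² = -1` would give `y² = -1`.
  have hx : x ≠ 0 := by
    rintro rfl
    rw [zero_smul, zero_add] at hxy
    have h2 := algJ_algJ (X 1)
    rw [hxy, algJ_smul, hxy, smul_smul] at h2
    have h3 := congrArg (fun Z => algMetric Z (X 1)) h2
    simp only [← neg_one_smul ℝ (X 1), algMetric_smul_left] at h3
    nlinarith [mul_self_nonneg y]
  have hcross : cross (X 1).1 (X 1).2 = 0 := by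
    refine cross_eq_zero_of_algCurv_eq_zero (htr 1).1 (htr 1).2 hpos1.ne' ?_
    rw [hxy, algCurv_smul_left, algCurv_add_left, algCurv_smul_left, algCurv_smul_left, hR,
      algCurv_self, smul_zero, smul_zero, add_zero, smul_zero]
  obtain ⟨l, hl, p, q, hp, hq⟩ := exists_line_of_cross_eq_zero (htr 1).1 (htr 1).2 hcross
  have hX1 : X 1 = (p • l, q • l) := Prod.ext hp hq
  refine ⟨l, hl, ?_, ?_⟩
  · rw [hX1, algMetric_smul_line] at hpos1
    by_contra! hle
    nlinarith [mul_nonneg (by nlinarith [sq_nonneg (p - q), sq_nonneg p, sq_nonneg q] :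
      0 ≤ 2 / 3 * (p ^ 2 - p * q + q ^ 2)) (neg_nonneg.2 hle)]
  -- `X 0` is recovered from `X 1` and `J (X 1)`, and `ℝ l × ℝ l` is stable under `J`.
  · have hX0 : X 0 = x⁻¹ • (algJ (X 1) - y • X 1) := by
      rw [hxy, add_sub_cancel_right, smul_smul, inv_mul_cancel₀ hx, one_smul]
    intro i
    fin_cases i
    · refine ⟨x⁻¹ * (1 / √3 * (p - 2 * q) - y * p), x⁻¹ * (1 / √3 * (2 * p - q) - y * q), ?_⟩
      change X 0 = _
      rw [hX0, hX1]
      refine Prod.ext ?_ ?_ <;>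
        simp only [algJ, Prod.smul_mk, Prod.mk_sub_mk] <;> module
    · exact ⟨p, q, hX1⟩

/-- Every term is a multiple of `cross l l`. -/
theorem algConn_eq_zero_of_line (l : Mat2) (p q p' q' : ℝ) :
    algConn (p • l, q • l) (p' • l, q' • l) = 0 := by
  simp [algConn, cross_smul_left, cross_smul_right, cross_self]

/-- The hypotheses on a local parametrization of an almost complex, totally geodesic, flat surface
with positive definite induced metric. -/
structure IsFlatGeodesicChart (G : Plane → SL2 × SL2) (U : Set Plane) : Prop where
  isOpen : IsOpen U
  smooth : SmoothEntriesOn (fun w => (((G w).1 : Mat2), ((G w).2 : Mat2))) U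
  pos : ∀ u ∈ U, ∀ x y : ℝ, x ≠ 0 ∨ y ≠ 0 →
    0 < algMetric (x • frame G 0 u + y • frame G 1 u) (x • frame G 0 u + y • frame G 1 u)
  complex : ∀ u ∈ U, ∃ x y : ℝ, algJ (frame G 1 u) = x • frame G 0 u + y • frame G 1 u
  geodesic : ∀ u ∈ U, ∀ i j, secondForm G i j u = 0
  flat : ∀ u ∈ U, gaussCurvature (firstForm G) u = 0

namespace IsFlatGeodesicChart

variable {G : Plane → SL2 × SL2} {U : Set Plane} {u : Plane}

theorem det_firstForm_ne_zero (hG : IsFlatGeodesicChart G U) (hu : u ∈ U) :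
    (firstForm G u).det ≠ 0 := by
  have h0 : 0 < algMetric (frame G 0 u) (frame G 0 u) := by
    simpa using hG.pos u hu 1 0 (Or.inl one_ne_zero)
  -- For `v = -g₀₁ X₀ + g₀₀ X₁`, which is orthogonal to `X₀`, one has `g(v, v) = g₀₀ det g`.
  have h1 := hG.pos u hu (-algMetric (frame G 0 u) (frame G 1 u))
    (algMetric (frame G 0 u) (frame G 0 u)) (Or.inr h0.ne')
  simp only [algMetric_add_left, algMetric_add_right, algMetric_smul_left, algMetric_smul_right,
    algMetric_comm (frame G 1 u) (frame G 0 u)] at h1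
  rw [Matrix.det_fin_two]
  simp only [firstForm_apply, algMetric_comm (frame G 1 u) (frame G 0 u)]
  intro h
  nlinarith

/-- The vector `R(X₀, X₁) X₁ = x X₀ + y X₁` is tangent, orthogonal to `X₀` by flatness and to `X₁`
by skewness, hence orthogonal to itself. -/
theorem algCurv_frame_eq_zero (hG : IsFlatGeodesicChart G U) (hu : u ∈ U) :
    algCurv (frame G 0 u) (frame G 1 u) (frame G 1 u) = 0 := by
  have hsum := sum_curvature_smul_eq_algCurv hG.isOpen (X := frame G)
    (Γ := christoffel (firstForm G)) (smoothEntriesOn_frame hG.isOpen hG.smooth)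
    (fun k i j w hw => differentiableAt_christoffel hG.isOpen
      (contDiffOn_firstForm hG.isOpen hG.smooth) hw (hG.det_firstForm_ne_zero hw) k i j)
    (christoffel_firstForm_symm G)
    (fun i j w hw => matDeriv_frame_of_secondForm_eq_zero (hG.geodesic w hw i j)) hu
  change ∑ l, riemann (firstForm G) l 1 0 1 u • frame G l u = _ at hsum
  have hflat : ∑ l, riemann (firstForm G) l 1 0 1 u * firstForm G u l 0 = 0 :=
    (div_eq_zero_iff.1 (hG.flat u hu)).resolve_right (hG.det_firstForm_ne_zero hu)
  rw [Fin.sum_univ_two] at hsum hflat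
  simp only [firstForm_apply] at hflat
  set x := riemann (firstForm G) 0 1 0 1 u
  set y := riemann (firstForm G) 1 1 0 1 u
  have hself := algMetric_algCurv_self (frame G 0 u) (frame G 1 u) (frame G 1 u)
  rw [← hsum] at hself
  by_cases hxy : x = 0 ∧ y = 0
  · rw [← hsum, hxy.1, hxy.2, zero_smul, zero_smul, add_zero]
  · have hlt := hG.pos u hu x y (by tauto)
    rw [algMetric_add_right, algMetric_smul_right, algMetric_smul_right, hself,
      algMetric_add_left, algMetric_smul_left, algMetric_smul_left, hflat] at hlt
    simp at hlt

theorem exists_line (hG : IsFlatGeodesicChart G U) (hu : u ∈ U) :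
    ∃ l : Mat2, l.trace = 0 ∧ 0 < bil l l ∧ ∀ i, ∃ p q : ℝ, frame G i u = (p • l, q • l) :=
  exists_line_of_algCurv_eq_zero (X := fun i => frame G i u)
    (trace_frame (hG.smooth.differentiableAt hG.isOpen hu)) (hG.pos u hu) (hG.complex u hu)
    (hG.algCurv_frame_eq_zero hu)

/-- If the tangent plane lay in the second factor, so would `J X₁`, whose first component is a
nonzero multiple of the second component of `X₁`; then `X₁ = 0`. -/
theorem exists_fst_frame_ne_zero (hG : IsFlatGeodesicChart G U) (hu : u ∈ U) :
    ∃ j, (frame G j u).1 ≠ 0 := by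
  by_contra! h
  obtain ⟨x, y, hxy⟩ := hG.complex u hu
  have h1 := congrArg Prod.fst hxy
  have h3 : 1 / √3 ≠ 0 := by positivity
  simp only [algJ, Prod.fst_add, Prod.smul_fst, h 0, h 1, smul_zero, add_zero, zero_sub,
    smul_neg, neg_eq_zero, smul_eq_zero, h3, two_ne_zero, false_or] at h1
  have hpos := hG.pos u hu 0 1 (Or.inr one_ne_zero)
  rw [zero_smul, zero_add, one_smul, show frame G 1 u = 0 from Prod.ext (h 1) h1,
    algMetric_zero_left] at hpos
  exact lt_irrefl _ hpos

/-- As `algConn` vanishes on `ℝ l × ℝ l`, the derivative of a frame vector is a combination of frame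
vectors; both first components are then multiples of the same `l`. This is the infinitesimal form of
constancy of the line. -/
theorem fst_matDeriv_frame_proportional (hG : IsFlatGeodesicChart G U) (hu : u ∈ U)
    (i j a b c d : Fin 2) :
    (matDeriv i (frame G j) u).1 a b * (frame G j u).1 c d =
      (frame G j u).1 a b * (matDeriv i (frame G j) u).1 c d := by
  obtain ⟨l, -, -, hl⟩ := hG.exists_line hu
  choose p q hpq using hl
  rw [matDeriv_frame_of_secondForm_eq_zero (hG.geodesic u hu i j), hpq i, hpq j,
    algConn_eq_zero_of_line, Fin.sum_univ_two, hpq 0, hpq 1]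
  simp only [sub_zero, Prod.fst_add, Prod.smul_fst, Matrix.add_apply, Matrix.smul_apply,
    smul_eq_mul]
  ring

end IsFlatGeodesicChart

theorem fderiv_eq_zero_of_coordDeriv_eq_zero {f : Plane → ℝ} {u : Plane}
    (h : ∀ i, coordDeriv i f u = 0) : fderiv ℝ f u = 0 := by
  ext v
  have hv : v = v 0 • EuclideanSpace.single (0 : Fin 2) (1 : ℝ)
      + v 1 • EuclideanSpace.single (1 : Fin 2) (1 : ℝ) := by
    ext i; fin_cases i <;> simp
  have h0 := h 0
  have h1 := h 1
  rw [coordDeriv] at h0 h1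
  rw [hv, map_add, map_smul, map_smul, h0, h1]
  simp

/-- Locally, the tangent planes in the left trivialization are a constant plane `ℝ l × ℝ l`. -/
theorem IsFlatGeodesicChart.eventually_frame_mem_line {G : Plane → SL2 × SL2} {U : Set Plane}
    (hG : IsFlatGeodesicChart G U) {u₀ : Plane} (hu₀ : u₀ ∈ U) :
    ∃ l : Mat2, l.trace = 0 ∧ 0 < bil l l ∧
      ∀ᶠ u in nhds u₀, ∀ i, ∃ p q : ℝ, frame G i u = (p • l, q • l) := by
  obtain ⟨j, hj⟩ := hG.exists_fst_frame_ne_zero hu₀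
  obtain ⟨a, b, hab⟩ : ∃ a b, (frame G j u₀).1 a b ≠ 0 := by
    by_contra! hcon
    exact hj (Matrix.ext hcon)
  have hsm := smoothEntriesOn_frame hG.isOpen hG.smooth j
  have hcont : ContinuousAt (fun u => (frame G j u).1 a b) u₀ :=
    ((hsm.1 a b).contDiffAt (hG.isOpen.mem_nhds hu₀)).continuousAt
  obtain ⟨r, hr, hball⟩ := Metric.eventually_nhds_iff_ball.1
    ((hcont.eventually_ne hab).and (hG.isOpen.mem_nhds hu₀))
  -- Ratios of entries determine the line. Their derivatives vanish by proportionality of the frame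
  -- vector and its derivative.
  have hconst : ∀ c d, ∀ u ∈ Metric.ball u₀ r,
      (frame G j u).1 c d / (frame G j u).1 a b = (frame G j u₀).1 c d / (frame G j u₀).1 a b := by
    intro c d u hu
    have hdiff : ∀ w ∈ Metric.ball u₀ r, ∀ c d,
        DifferentiableAt ℝ (fun w => (frame G j w).1 c d) w := fun w hw c d =>
      (hsm.differentiableAt hG.isOpen (hball w hw).2).1 c d
    have hquot : ∀ w ∈ Metric.ball u₀ r, DifferentiableAt ℝ
        (fun w => (frame G j w).1 c d / (frame G j w).1 a b) w := by
      intro w hw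
      simp only [div_eq_mul_inv]
      exact (hdiff w hw c d).mul ((hdiff w hw a b).inv (hball w hw).1)
    refine Metric.isOpen_ball.is_const_of_fderiv_eq_zero
      (convex_ball u₀ r).isPreconnected
      (fun w hw => (hquot w hw).differentiableWithinAt) (fun w hw => ?_) hu (Metric.mem_ball_self hr)
    refine fderiv_eq_zero_of_coordDeriv_eq_zero fun i => ?_
    have hprop := hG.fst_matDeriv_frame_proportional (hball w hw).2 i j c d a b
    change coordDeriv i (fun w => (frame G j w).1 c d) w * _ =
      _ * coordDeriv i (fun w => (frame G j w).1 a b) w at hprop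
    -- The quotient rule, obtained from the product rule for quotient times denominator.
    have hmul : coordDeriv i (fun w => (frame G j w).1 c d) w =
        coordDeriv i (fun w => (frame G j w).1 c d / (frame G j w).1 a b) w * (frame G j w).1 a b
        + (frame G j w).1 c d / (frame G j w).1 a b *
          coordDeriv i (fun w => (frame G j w).1 a b) w := by
      rw [← coordDeriv_mul (f := fun w => (frame G j w).1 c d / (frame G j w).1 a b)
        (g := fun w => (frame G j w).1 a b) (hquot w hw) (hdiff w hw a b)]
      refine coordDeriv_congr ?_
      filter_upwards [Metric.isOpen_ball.mem_nhds hw] with z hz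
      rw [div_mul_cancel₀ _ (hball z hz).1]
    have hne := (hball w hw).1
    rw [hmul] at hprop
    have hz : coordDeriv i (fun w => (frame G j w).1 c d / (frame G j w).1 a b) w *
        ((frame G j w).1 a b * (frame G j w).1 a b) = 0 := by
      field_simp at hprop
      linarith
    exact (mul_eq_zero.1 hz).resolve_right (mul_ne_zero hne hne)
  have hscale : ∀ u ∈ Metric.ball u₀ r, (frame G j u).1 =
      ((frame G j u).1 a b / (frame G j u₀).1 a b) • (frame G j u₀).1 := by
    intro u hu
    ext c d
    have h := hconst c d u hu
    have hne := (hball u hu).1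
    rw [Matrix.smul_apply, smul_eq_mul]
    field_simp at h ⊢
    linarith
  refine ⟨(frame G j u₀).1, (trace_frame (hG.smooth.differentiableAt hG.isOpen hu₀) j).1, ?_, ?_⟩
  · obtain ⟨l, -, hl, hlp⟩ := hG.exists_line hu₀
    obtain ⟨p, q, hpq⟩ := hlp j
    have hp : p ≠ 0 := by
      rintro rfl
      rw [hpq] at hj
      simp at hj
    rw [hpq, bil_smul_smul]
    positivity
  · filter_upwards [Metric.ball_mem_nhds u₀ hr] with u hu i
    obtain ⟨l, -, -, hlp⟩ := hG.exists_line (hball u hu).2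
    obtain ⟨p, q, hpq⟩ := hlp j
    have hp : p ≠ 0 := by
      rintro rfl
      have := (hball u hu).1
      rw [hpq] at this
      simp at this
    -- The line at `u` contains the nonzero vector `(frame G j u).1`, which is a multiple of the
    -- fixed one; so the other frame vector lies on the fixed line too.
    obtain ⟨c, hl⟩ : ∃ c : ℝ, l = c • (frame G j u₀).1 := by
      refine ⟨p⁻¹ * ((frame G j u).1 a b / (frame G j u₀).1 a b), ?_⟩
      rw [mul_smul, ← hscale u hu, hpq, smul_smul, inv_mul_cancel₀ hp, one_smul]
    obtain ⟨p', q', h'⟩ := hlp i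
    exact ⟨p' * c, q' * c, by rw [h', hl, smul_smul, smul_smul]⟩

/-! ### From charts to the surface -/

section Surface

variable {M : Type*} [TopologicalSpace M] [ChartedSpace Plane M]

theorem differential_add (F : M → SL2 × SL2) (x : M) (v w : TangentSpace (𝓡 2) x) :
    differential F x (v + w) = differential F x v + differential F x w := by
  ext a b <;> simp only [differential, map_add, Prod.fst_add, Prod.snd_add,
    Matrix.add_apply] <;> rfl

theorem differential_smul (F : M → SL2 × SL2) (x : M) (c : ℝ) (v : TangentSpace (𝓡 2) x) :
    differential F x (c • v) = c • differential F x v := by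
  ext a b <;> simp only [differential, map_smul, Prod.smul_fst, Prod.smul_snd,
    Matrix.smul_apply] <;> rfl

/-- A nonzero tangent vector is what forces two lines that both describe the same tangent plane to
coincide. -/
theorem leftTriv_differential_ne_zero {F : M → SL2 × SL2} (hF : IsAlmostComplexSurface F) (x : M) :
    ∃ v : TangentSpace (𝓡 2) x, leftTriv (F x) (differential F x v) ≠ 0 := by
  obtain ⟨v, hv⟩ : ∃ v : TangentSpace (𝓡 2) x, v ≠ 0 :=
    ⟨_, (by simp : (EuclideanSpace.single (0 : Fin 2) (1 : ℝ) : Plane) ≠ 0)⟩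
  refine ⟨v, fun h => hv (hF.immersion x ?_)⟩
  have h1 := leftTranslate_leftTriv (F x) (differential F x v)
  have h2 : differential F x 0 = 0 := by
    rw [← zero_smul ℝ (0 : TangentSpace (𝓡 2) x), differential_smul, zero_smul]
  rw [h] at h1
  rw [h2, ← h1]
  simp [leftTranslate]

variable [IsManifold (𝓡 2) ∞ M]

theorem contDiffOn_comp_symm {f : M → ℝ} (hf : ContMDiff (𝓡 2) 𝓘(ℝ, ℝ) ∞ f)
    {e : OpenPartialHomeomorph M Plane} (he : e ∈ atlas Plane M) :
    ContDiffOn ℝ ∞ (fun w => f (e.symm w)) e.target :=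
  contMDiffOn_iff_contDiffOn.1 (hf.comp_contMDiffOn
    (contMDiffOn_symm_of_mem_maximalAtlas (IsManifold.subset_maximalAtlas he)))

theorem mdifferentiable_of_mem_atlas_plane {e : OpenPartialHomeomorph M Plane}
    (he : e ∈ atlas Plane M) : e.MDifferentiable (𝓡 2) (𝓡 2) :=
  haveI : IsManifold (𝓡 2) 1 M := IsManifold.of_le (n := ∞) (by simp)
  mdifferentiable_of_mem_atlas he

theorem fderiv_comp_symm {f : M → ℝ} (hf : ContMDiff (𝓡 2) 𝓘(ℝ, ℝ) ∞ f)
    {e : OpenPartialHomeomorph M Plane} (he : e ∈ atlas Plane M) {u : Plane} (hu : u ∈ e.target)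
    (v : Plane) :
    fderiv ℝ (fun w => f (e.symm w)) u v =
      mfderiv (𝓡 2) 𝓘(ℝ, ℝ) f (e.symm u) (mfderiv (𝓡 2) (𝓡 2) e.symm u v) := by
  have h := mfderiv_comp u (hf.mdifferentiableAt (by simp) (x := e.symm u))
    ((mdifferentiable_of_mem_atlas_plane he).mdifferentiableAt_symm hu)
  rw [mfderiv_eq_fderiv] at h
  exact congrArg (fun L : Plane →L[ℝ] ℝ => L v) h

theorem velocity_comp_symm {F : M → SL2 × SL2} (hF : IsAlmostComplexSurface F)
    {e : OpenPartialHomeomorph M Plane} (he : e ∈ atlas Plane M) {u : Plane} (hu : u ∈ e.target)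
    (i : Fin 2) :
    velocity (fun w => F (e.symm w)) i u = differential F (e.symm u)
      (mfderiv (𝓡 2) (𝓡 2) e.symm u (EuclideanSpace.single i (1 : ℝ))) :=
  Prod.ext (Matrix.ext fun a b => fderiv_comp_symm (hF.smooth a b).1 he hu _)
    (Matrix.ext fun a b => fderiv_comp_symm (hF.smooth a b).2 he hu _)

theorem leftTriv_differential_mfderiv_symm {F : M → SL2 × SL2} (hF : IsAlmostComplexSurface F)
    {e : OpenPartialHomeomorph M Plane} (he : e ∈ atlas Plane M) {u : Plane} (hu : u ∈ e.target)
    (v : Plane) :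
    leftTriv (F (e.symm u)) (differential F (e.symm u) (mfderiv (𝓡 2) (𝓡 2) e.symm u v)) =
      v 0 • frame (fun w => F (e.symm w)) 0 u + v 1 • frame (fun w => F (e.symm w)) 1 u := by
  have hv : v = v 0 • EuclideanSpace.single (0 : Fin 2) (1 : ℝ)
      + v 1 • EuclideanSpace.single (1 : Fin 2) (1 : ℝ) := by
    ext i; fin_cases i <;> simp
  have h : mfderiv (𝓡 2) (𝓡 2) e.symm u v =
      v 0 • mfderiv (𝓡 2) (𝓡 2) e.symm u (EuclideanSpace.single (0 : Fin 2) (1 : ℝ))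
      + v 1 • mfderiv (𝓡 2) (𝓡 2) e.symm u (EuclideanSpace.single (1 : Fin 2) (1 : ℝ)) := by
    conv_lhs => rw [hv]
    exact (map_add _ _ _).trans (congrArg₂ _ (map_smul _ _ _) (map_smul _ _ _))
  rw [h, differential_add, differential_smul, differential_smul, ← velocity_comp_symm hF he hu,
    ← velocity_comp_symm hF he hu, leftTriv_add, leftTriv_smul, leftTriv_smul]
  rfl

theorem mfderiv_symm_surjective {e : OpenPartialHomeomorph M Plane}
    (he : e ∈ atlas Plane M) {u : Plane} (hu : u ∈ e.target)
    (v : TangentSpace (𝓡 2) (e.symm u)) :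
    ∃ w : Plane, mfderiv (𝓡 2) (𝓡 2) e.symm u w = v :=
  (mdifferentiable_of_mem_atlas_plane he).symm.mfderiv_surjective hu v

theorem mfderiv_symm_injective {e : OpenPartialHomeomorph M Plane}
    (he : e ∈ atlas Plane M) {u : Plane} (hu : u ∈ e.target) :
    Function.Injective (mfderiv (𝓡 2) (𝓡 2) e.symm u) :=
  (mdifferentiable_of_mem_atlas_plane he).symm.mfderiv_injective hu

theorem isFlatGeodesicChart {F : M → SL2 × SL2} (hF : IsAlmostComplexSurface F)
    (hpos : HasPosDefMetric F) (hgeod : IsTotallyGeodesic F) (hflat : IsFlat F)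
    {e : OpenPartialHomeomorph M Plane} (he : e ∈ atlas Plane M) :
    IsFlatGeodesicChart (fun w => F (e.symm w)) e.target where
  isOpen := e.open_target
  smooth := ⟨fun a b => contDiffOn_comp_symm (hF.smooth a b).1 he,
    fun a b => contDiffOn_comp_symm (hF.smooth a b).2 he⟩
  pos := by
    intro u hu x y hxy
    have hv : mfderiv (𝓡 2) (𝓡 2) e.symm u (!₂[x, y] : Plane) ≠ 0 := by
      intro h0
      have h1 : (!₂[x, y] : Plane) = 0 :=
        mfderiv_symm_injective he hu (h0.trans (map_zero (mfderiv (𝓡 2) (𝓡 2) e.symm u)).symm)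
      have hx := congrArg (fun z : Plane => z 0) h1
      have hy := congrArg (fun z : Plane => z 1) h1
      simp at hx hy
      tauto
    have h := hpos _ _ hv
    rw [inducedMetric, metric, leftTriv_differential_mfderiv_symm hF he hu] at h
    simpa using h
  complex := by
    intro u hu
    obtain ⟨w, hw⟩ := hF.complex (e.symm u)
      (mfderiv (𝓡 2) (𝓡 2) e.symm u (EuclideanSpace.single (1 : Fin 2) (1 : ℝ)))
    obtain ⟨w', rfl⟩ := mfderiv_symm_surjective he hu w
    have h := congrArg (leftTriv (F (e.symm u))) hw
    rw [almostComplex, leftTriv_leftTranslate, leftTriv_differential_mfderiv_symm hF he hu,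
      leftTriv_differential_mfderiv_symm hF he hu] at h
    exact ⟨w' 0, w' 1, by simpa using h⟩
  geodesic := fun u hu i j => hgeod e he u hu i j
  flat := fun u hu => hflat e he u hu

theorem eventually_differential_mem_line {F : M → SL2 × SL2} (hF : IsAlmostComplexSurface F)
    (hpos : HasPosDefMetric F) (hgeod : IsTotallyGeodesic F) (hflat : IsFlat F) (x : M) :
    ∃ l : Mat2, l.trace = 0 ∧ 0 < bil l l ∧ ∀ᶠ y in nhds x, ∀ v : TangentSpace (𝓡 2) y,
      ∃ p q : ℝ, leftTriv (F y) (differential F y v) = (p • l, q • l) := by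
  have he := chart_mem_atlas Plane x
  have hx := mem_chart_source Plane x
  obtain ⟨l, hl, hl', hev⟩ := (isFlatGeodesicChart hF hpos hgeod hflat he).eventually_frame_mem_line
    ((chartAt Plane x).map_source hx)
  refine ⟨l, hl, hl', ?_⟩
  filter_upwards [((chartAt Plane x).continuousAt hx).eventually hev,
    (chartAt Plane x).open_source.mem_nhds hx] with y hy hys
  have hyt := (chartAt Plane x).map_source hys
  obtain ⟨u, hu, rfl⟩ : ∃ u ∈ (chartAt Plane x).target, (chartAt Plane x).symm u = y :=
    ⟨_, hyt, (chartAt Plane x).left_inv hys⟩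
  rw [(chartAt Plane x).right_inv hu] at hy
  intro v
  obtain ⟨w, rfl⟩ := mfderiv_symm_surjective he hu v
  choose p q hpq using hy
  refine ⟨w 0 * p 0 + w 1 * p 1, w 0 * q 0 + w 1 * q 1, ?_⟩
  rw [leftTriv_differential_mfderiv_symm hF he hu, hpq 0, hpq 1]
  refine Prod.ext ?_ ?_ <;> simp only [Prod.smul_mk, Prod.mk_add_mk] <;> module

/-- The tangent planes of the surface in the left trivialization are a constant plane
`ℝ l × ℝ l`. -/
theorem exists_line_forall_differential [ConnectedSpace M] {F : M → SL2 × SL2}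
    (hF : IsAlmostComplexSurface F)
    (hpos : HasPosDefMetric F) (hgeod : IsTotallyGeodesic F) (hflat : IsFlat F) :
    ∃ l : Mat2, l.trace = 0 ∧ 0 < bil l l ∧ ∀ (y : M) (v : TangentSpace (𝓡 2) y),
      ∃ p q : ℝ, leftTriv (F y) (differential F y v) = (p • l, q • l) := by
  have x₀ : M := Classical.arbitrary M
  obtain ⟨l, hl, hl', hev⟩ := eventually_differential_mem_line hF hpos hgeod hflat x₀
  refine ⟨l, hl, hl', ?_⟩
  set S : Set M := {y | ∀ v : TangentSpace (𝓡 2) y,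
      ∃ p q : ℝ, leftTriv (F y) (differential F y v) = (p • l, q • l)} with hS
  -- Near `x` one line `m` serves all points, so membership of a single point in `S` makes `m` a
  -- multiple of `l` and puts all the others in `S`.
  have hloc : ∀ x, ∀ᶠ y in nhds x, (y ∈ S ↔ x ∈ S) := by
    intro x
    obtain ⟨m, hm, hm', hevm⟩ := eventually_differential_mem_line hF hpos hgeod hflat x
    have hsub : ∀ y ∈ S, (∀ v : TangentSpace (𝓡 2) y,
        ∃ p q : ℝ, leftTriv (F y) (differential F y v) = (p • m, q • m)) →
        ∃ c : ℝ, m = c • l := by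
      intro y hy hym
      obtain ⟨v, hv⟩ := leftTriv_differential_ne_zero hF y
      obtain ⟨p, q, hpq⟩ := hy v
      obtain ⟨p', q', hpq'⟩ := hym v
      rw [hpq'] at hpq
      have h1 := congrArg Prod.fst hpq
      have h2 := congrArg Prod.snd hpq
      simp only at h1 h2
      by_cases hp : p' = 0
      · by_cases hq : q' = 0
        · rw [hpq', hp, hq, zero_smul] at hv
          exact absurd rfl hv
        · exact ⟨q'⁻¹ * q, by rw [mul_smul, ← h2, smul_smul, inv_mul_cancel₀ hq, one_smul]⟩
      · exact ⟨p'⁻¹ * p, by rw [mul_smul, ← h1, smul_smul, inv_mul_cancel₀ hp, one_smul]⟩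
    filter_upwards [hevm] with y hy
    have hmS : ∀ z, (∀ v : TangentSpace (𝓡 2) z,
        ∃ p q : ℝ, leftTriv (F z) (differential F z v) = (p • m, q • m)) →
        (∃ c : ℝ, m = c • l) → z ∈ S := by
      rintro z hz ⟨c, hc⟩ v
      obtain ⟨p, q, hpq⟩ := hz v
      exact ⟨p * c, q * c, by rw [hpq, hc, smul_smul, smul_smul]⟩
    exact ⟨fun h => hmS x hevm.self_of_nhds (hsub y h hy),
      fun h => hmS y hy (hsub x h hevm.self_of_nhds)⟩
  have hclopen : IsClopen S := by
    refine ⟨⟨isOpen_iff_mem_nhds.2 fun x hx => ?_⟩, isOpen_iff_mem_nhds.2 fun x hx => ?_⟩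
    · filter_upwards [hloc x] with y hy using fun h => hx (hy.1 h)
    · filter_upwards [hloc x] with y hy using hy.2 hx
  have huniv : S = Set.univ := hclopen.eq_univ ⟨x₀, hev.self_of_nhds⟩
  intro y
  have hy : y ∈ S := huniv ▸ Set.mem_univ y
  exact hy

end Surface

/-! ### Integration of one factor -/

/-- The matrix `diag (1, -1)`. -/
def diagGen : Mat2 := !![1, 0; 0, -1]

/-- A trace-free matrix of positive square is conjugate to a multiple of `diag (1, -1)`. -/
theorem exists_conj_diagGen {l : Mat2} (hl : l.trace = 0) (hpos : 0 < bil l l) :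
    ∃ (n : SL2) (r : ℝ), l = r • ((n : Mat2) * diagGen * ((n⁻¹ : SL2) : Mat2)) := by
  have e := entries_of_trace_eq_zero hl
  have hb : bil l l = l 0 0 ^ 2 + l 0 1 * l 1 0 := by rw [bil, e]; ring
  rw [hb] at hpos
  -- The eigenvalues of `l` are the two square roots of `bil l l`; the sign of `r` is chosen so that
  -- the eigenvectors below do not degenerate.
  obtain ⟨r, hr, hr0, hr1⟩ : ∃ r : ℝ, r ^ 2 = l 0 0 ^ 2 + l 0 1 * l 1 0 ∧ r ≠ 0 ∧
      r + l 0 0 ≠ 0 := by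
    have hs := Real.sq_sqrt hpos.le
    have hs0 := (Real.sqrt_pos.2 hpos).ne'
    by_cases h : √(l 0 0 ^ 2 + l 0 1 * l 1 0) + l 0 0 = 0
    · refine ⟨-√(l 0 0 ^ 2 + l 0 1 * l 1 0), by rw [neg_sq, hs], neg_ne_zero.2 hs0, fun h' => ?_⟩
      exact hs0 (by linarith)
    · exact ⟨_, hs, hs0, h⟩
  -- The columns are eigenvectors of `l` for `r` and `-r`, the second scaled to make the determinant
  -- `1`.
  have hdet : (!![r + l 0 0, -l 0 1 / (2 * r * (r + l 0 0)); l 1 0, 1 / (2 * r)] : Mat2).det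
      = 1 := by
    rw [Matrix.det_fin_two_of]
    field_simp
    linear_combination -hr
  obtain ⟨n, hn⟩ : ∃ n : SL2, (n : Mat2) =
      !![r + l 0 0, -l 0 1 / (2 * r * (r + l 0 0)); l 1 0, 1 / (2 * r)] := ⟨⟨_, hdet⟩, rfl⟩
  refine ⟨n, r, ?_⟩
  rw [coe_inv_fin_two, hn]
  ext i j
  fin_cases i <;> fin_cases j <;>
    simp [diagGen, e] <;> field_simp
  · linear_combination (-1 : ℝ) * hr
  · linear_combination (0 : ℝ) * hr
  · linear_combination (0 : ℝ) * hr
  · linear_combination (1 : ℝ) * hr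

section Surface

variable {M : Type*} [TopologicalSpace M] [ChartedSpace Plane M]

/-- The derivative of a function along a tangent vector, as a real number. -/
noncomputable def dirDeriv (f : M → ℝ) (x : M) (v : TangentSpace (𝓡 2) x) : ℝ :=
  mfderiv (𝓡 2) 𝓘(ℝ, ℝ) f x v

/-- The derivative of a matrix-valued map, entry by entry. -/
noncomputable def entryDeriv (A : M → Mat2) (x : M) (v : TangentSpace (𝓡 2) x) : Mat2 :=
  Matrix.of fun a b => dirDeriv (fun y => A y a b) x v

theorem entryDeriv_mul_mul {A : M → Mat2}
    (hA : ∀ a b, ContMDiff (𝓡 2) 𝓘(ℝ, ℝ) ∞ (fun y => A y a b)) (P Q : Mat2) (x : M)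
    (v : TangentSpace (𝓡 2) x) :
    entryDeriv (fun y => P * A y * Q) x v = P * entryDeriv A x v * Q := by
  have hd : ∀ a b, HasMFDerivAt (𝓡 2) 𝓘(ℝ, ℝ) (fun y => A y a b) x
      (mfderiv (𝓡 2) 𝓘(ℝ, ℝ) (fun y => A y a b) x) := fun a b =>
    ((hA a b).mdifferentiableAt (by simp)).hasMFDerivAt
  ext a b
  have h := ((((hd 0 0).const_smul (P a 0 * Q 0 b)).add ((hd 0 1).const_smul (P a 0 * Q 1 b))).add
    ((hd 1 0).const_smul (P a 1 * Q 0 b))).add ((hd 1 1).const_smul (P a 1 * Q 1 b))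
  have hfun : (fun y => (P * A y * Q) a b) = ((P a 0 * Q 0 b) • (fun y => A y 0 0) +
      (P a 0 * Q 1 b) • (fun y => A y 0 1) + (P a 1 * Q 0 b) • (fun y => A y 1 0) +
      (P a 1 * Q 1 b) • fun y => A y 1 1) := by
    funext y
    simp only [Matrix.mul_apply, Fin.sum_univ_two, Pi.add_apply, Pi.smul_apply, smul_eq_mul]
    ring
  rw [← hfun] at h
  have hv := congrArg (fun L : Plane →L[ℝ] ℝ => L v) h.mfderiv
  refine (Eq.trans hv ?_ : dirDeriv (fun y => (P * A y * Q) a b) x v = _)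
  simp only [Matrix.mul_apply, Fin.sum_univ_two, entryDeriv]
  change P a 0 * Q 0 b * dirDeriv (fun y => A y 0 0) x v
    + P a 0 * Q 1 b * dirDeriv (fun y => A y 0 1) x v
    + P a 1 * Q 0 b * dirDeriv (fun y => A y 1 0) x v
    + P a 1 * Q 1 b * dirDeriv (fun y => A y 1 1) x v =
    (P a 0 * dirDeriv (fun y => A y 0 0) x v
      + P a 1 * dirDeriv (fun y => A y 1 0) x v) * Q 0 b
    + (P a 0 * dirDeriv (fun y => A y 0 1) x v
      + P a 1 * dirDeriv (fun y => A y 1 1) x v) * Q 1 b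
  ring

theorem contMDiff_mul_mul_entry {A : M → Mat2}
    (hA : ∀ a b, ContMDiff (𝓡 2) 𝓘(ℝ, ℝ) ∞ (fun y => A y a b)) (P Q : Mat2) (a b : Fin 2) :
    ContMDiff (𝓡 2) 𝓘(ℝ, ℝ) ∞ (fun y => (P * A y * Q) a b) := by
  simp only [Matrix.mul_apply, Fin.sum_univ_two]
  exact (((contMDiff_const.mul (hA 0 0)).add (contMDiff_const.mul (hA 1 0))).mul
    contMDiff_const).add (((contMDiff_const.mul (hA 0 1)).add (contMDiff_const.mul (hA 1 1))).mul
    contMDiff_const)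

theorem dirDeriv_mul {f g : M → ℝ} (hf : ContMDiff (𝓡 2) 𝓘(ℝ, ℝ) ∞ f)
    (hg : ContMDiff (𝓡 2) 𝓘(ℝ, ℝ) ∞ g) (x : M) (v : TangentSpace (𝓡 2) x) :
    dirDeriv (fun y => f y * g y) x v =
      f x * dirDeriv g x v + g x * dirDeriv f x v := by
  have h := ((hf.mdifferentiableAt (by simp) (x := x)).hasMFDerivAt.mul
    (hg.mdifferentiableAt (by simp) (x := x)).hasMFDerivAt).mfderiv
  exact congrArg (fun L : Plane →L[ℝ] ℝ => L v) h

theorem dirDeriv_log {f : M → ℝ} (hf : ContMDiff (𝓡 2) 𝓘(ℝ, ℝ) ∞ f) {x : M}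
    (hx : f x ≠ 0) (v : TangentSpace (𝓡 2) x) :
    dirDeriv (fun y => Real.log (f y)) x v =
      (f x)⁻¹ * dirDeriv f x v := by
  have h := ((Real.hasDerivAt_log hx).hasFDerivAt.hasMFDerivAt.comp x
    (hf.mdifferentiableAt (by simp) (x := x)).hasMFDerivAt).mfderiv
  refine (congrArg (fun L : Plane →L[ℝ] ℝ => L v) h).trans ?_
  exact mul_comm (dirDeriv f x v) (f x)⁻¹

variable [IsManifold (𝓡 2) ∞ M]

theorem eq_of_dirDeriv_eq_zero [ConnectedSpace M] {f : M → ℝ}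
    (hf : ContMDiff (𝓡 2) 𝓘(ℝ, ℝ) ∞ f)
    (h : ∀ x (v : TangentSpace (𝓡 2) x), dirDeriv f x v = 0) (x y : M) :
    f x = f y := by
  have hloc : IsLocallyConstant f := by
    rw [IsLocallyConstant.iff_eventually_eq]
    intro x
    have he := chart_mem_atlas Plane x
    have hx := mem_chart_source Plane x
    set e := chartAt Plane x
    obtain ⟨r, hr, hball⟩ := Metric.isOpen_iff.1 e.open_target _ (e.map_source hx)
    have hc : ∀ u ∈ Metric.ball (e x) r, f (e.symm u) = f (e.symm (e x)) := fun u hu =>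
      Metric.isOpen_ball.is_const_of_fderiv_eq_zero (f := fun w => f (e.symm w))
        (convex_ball (e x) r).isPreconnected
        (((contDiffOn_comp_symm hf he).differentiableOn (by simp)).mono hball)
        (fun w hw => by
          ext v
          rw [fderiv_comp_symm hf he (hball hw)]
          exact h _ _) hu (Metric.mem_ball_self hr)
    filter_upwards [(e.continuousAt hx).eventually (Metric.ball_mem_nhds (e x) hr),
      e.open_source.mem_nhds hx] with y hy hys
    have := hc _ hy
    rwa [e.left_inv hys, e.left_inv hx] at this
  exact hloc.apply_eq_of_preconnectedSpace x y

/-- A map into `SL(2, ℝ)` whose logarithmic derivative is a multiple of `n diag (1, -1) n⁻¹` is a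
translate of a one-parameter group. -/
theorem exists_eq_mul_expDiag_mul [ConnectedSpace M] {A : M → SL2} (n : SL2)
    (hA : ∀ a b, ContMDiff (𝓡 2) 𝓘(ℝ, ℝ) ∞ (fun y => (A y : Mat2) a b))
    (h : ∀ x (v : TangentSpace (𝓡 2) x), ∃ p : ℝ,
      (((A x)⁻¹ : SL2) : Mat2) * entryDeriv (fun y => (A y : Mat2)) x v =
        p • ((n : Mat2) * diagGen * ((n⁻¹ : SL2) : Mat2))) :
    ∃ (a : SL2) (P : M → ℝ), ContMDiff (𝓡 2) 𝓘(ℝ, ℝ) ∞ P ∧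
      (∀ x, A x = a * expDiag (P x) * n⁻¹) ∧
      ∀ x (v : TangentSpace (𝓡 2) x),
        (((A x)⁻¹ : SL2) : Mat2) * entryDeriv (fun y => (A y : Mat2)) x v =
          dirDeriv P x v •
            ((n : Mat2) * diagGen * ((n⁻¹ : SL2) : Mat2)) := by
  have x₀ : M := Classical.arbitrary M
  -- With this `a` the normalized map `D` equals `1` at `x₀` and solves `dD = θ D diag (1, -1)`.
  set a : SL2 := A x₀ * n
  set D : M → SL2 := fun x => a⁻¹ * A x * n with hD
  have hDcoe : ∀ x, (D x : Mat2) = ((a⁻¹ : SL2) : Mat2) * (A x : Mat2) * (n : Mat2) := fun x => by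
    rw [hD, Matrix.SpecialLinearGroup.coe_mul, Matrix.SpecialLinearGroup.coe_mul]
  have hDsm : ∀ i j, ContMDiff (𝓡 2) 𝓘(ℝ, ℝ) ∞ (fun y => (D y : Mat2) i j) := fun i j => by
    simp only [hDcoe]
    exact contMDiff_mul_mul_entry hA _ _ i j
  have hDx₀ : D x₀ = 1 := by simp [hD, a]
  have hinv : ∀ b : SL2, ((b⁻¹ : SL2) : Mat2) * (b : Mat2) = 1 := fun b => by
    rw [← Matrix.SpecialLinearGroup.coe_mul, inv_mul_cancel, Matrix.SpecialLinearGroup.coe_one]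
  have hinv' : ∀ b : SL2, (b : Mat2) * ((b⁻¹ : SL2) : Mat2) = 1 := fun b => by
    rw [← Matrix.SpecialLinearGroup.coe_mul, mul_inv_cancel, Matrix.SpecialLinearGroup.coe_one]
  choose θ hθ using h
  have hdD : ∀ x (v : TangentSpace (𝓡 2) x),
      entryDeriv (fun y => (D y : Mat2)) x v = θ x v • ((D x : Mat2) * diagGen) := by
    intro x v
    have h1 : entryDeriv (fun y => (A y : Mat2)) x v =
        θ x v • ((A x : Mat2) * ((n : Mat2) * diagGen * ((n⁻¹ : SL2) : Mat2))) := by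
      rw [← Matrix.mul_smul, ← hθ, ← Matrix.mul_assoc, hinv', Matrix.one_mul]
    simp only [hDcoe]
    rw [entryDeriv_mul_mul hA, h1, Matrix.mul_smul, Matrix.smul_mul]
    congr 1
    simp only [Matrix.mul_assoc, hinv, Matrix.mul_one]
  have hd0 : ∀ i x (v : TangentSpace (𝓡 2) x),
      dirDeriv (fun y => (D y : Mat2) i 0) x v = θ x v * (D x : Mat2) i 0 := by
    intro i x v
    have := congrFun (congrFun (hdD x v) i) 0
    simpa [entryDeriv, diagGen, Matrix.mul_apply, Fin.sum_univ_two] using this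
  have hd1 : ∀ i x (v : TangentSpace (𝓡 2) x),
      dirDeriv (fun y => (D y : Mat2) i 1) x v = -(θ x v * (D x : Mat2) i 1) := by
    intro i x v
    have := congrFun (congrFun (hdD x v) i) 1
    simpa [entryDeriv, diagGen, Matrix.mul_apply, Fin.sum_univ_two] using this
  -- The columns of `D` have logarithmic derivatives `θ` and `-θ`, so such products are constant.
  -- Their values at `x₀` make `D` diagonal.
  have hprod : ∀ i j x, (D x : Mat2) i 0 * (D x : Mat2) j 1 =
      (D x₀ : Mat2) i 0 * (D x₀ : Mat2) j 1 := fun i j x =>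
    eq_of_dirDeriv_eq_zero (f := fun y => (D y : Mat2) i 0 * (D y : Mat2) j 1)
      ((hDsm i 0).mul (hDsm j 1)) (fun x v => by
        rw [dirDeriv_mul (hDsm i 0) (hDsm j 1), hd0, hd1]; ring) x x₀
  simp only [hDx₀, Matrix.SpecialLinearGroup.coe_one] at hprod
  have h01 : ∀ x, (D x : Mat2) 0 0 * (D x : Mat2) 0 1 = 0 := fun x => by simpa using hprod 0 0 x
  have h0011 : ∀ x, (D x : Mat2) 0 0 * (D x : Mat2) 1 1 = 1 := fun x => by simpa using hprod 0 1 x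
  have h10 : ∀ x, (D x : Mat2) 1 0 * (D x : Mat2) 1 1 = 0 := fun x => by simpa using hprod 1 1 x
  have hne : ∀ x, (D x : Mat2) 0 0 ≠ 0 := fun x h0 => by
    have := h0011 x
    rw [h0, zero_mul] at this
    exact zero_ne_one this
  -- The entry never vanishes and is `1` at `x₀`, so connectedness keeps it positive. Its logarithm
  -- is a global primitive of `θ`, and no simple connectedness is needed.
  have hpos : ∀ x, 0 < (D x : Mat2) 0 0 := by
    intro x
    by_contra! hle
    obtain ⟨y, hy⟩ := mem_range_of_exists_le_of_exists_ge (hDsm 0 0).continuous ⟨x, hle⟩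
      ⟨x₀, by rw [hDx₀]; simp⟩
    exact hne y hy
  refine ⟨a, fun x => Real.log ((D x : Mat2) 0 0), ?_, ?_, ?_⟩
  · intro x
    exact (Real.contDiffAt_log.2 (hne x)).contMDiffAt.comp x (hDsm 0 0 x)
  · intro x
    have hexp : expDiag (Real.log ((D x : Mat2) 0 0)) = D x := by
      apply Subtype.ext
      have e01 := (mul_eq_zero.1 (h01 x)).resolve_left (hne x)
      have e11 : (D x : Mat2) 1 1 = ((D x : Mat2) 0 0)⁻¹ := eq_inv_of_mul_eq_one_right (h0011 x)
      have e10 := (mul_eq_zero.1 (h10 x)).resolve_right (by rw [e11]; exact inv_ne_zero (hne x))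
      ext i j
      fin_cases i <;> fin_cases j
      · exact Real.exp_log (hpos x)
      · exact e01.symm
      · exact e10.symm
      · exact ((Real.exp_neg _).trans (by rw [Real.exp_log (hpos x)])).trans e11.symm
    rw [hexp]
    simp [hD, mul_assoc]
  · intro x v
    rw [hθ, dirDeriv_log (hDsm 0 0) (hne x), hd0, mul_comm (θ x v), ← mul_assoc,
      inv_mul_cancel₀ (hne x), one_mul]

end Surface

/-! ### Flat coordinates and the inverse function theorem. -/

section Surface

variable {M : Type*} [TopologicalSpace M] [ChartedSpace Plane M]

theorem bil_conj_diagGen (n : SL2) :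
    bil ((n : Mat2) * diagGen * ((n⁻¹ : SL2) : Mat2)) ((n : Mat2) * diagGen * ((n⁻¹ : SL2) : Mat2))
      = 1 := by
  have h := bil_conj n⁻¹ diagGen diagGen
  rw [inv_inv] at h
  rw [h]
  simp [bil, diagGen]
  norm_num

theorem algMetric_line_line (l : Mat2) (p q p' q' : ℝ) :
    algMetric (p • l, q • l) (p' • l, q' • l) =
      (2 / 3 * (p * p' + q * q') - 1 / 3 * (q * p' + p * q')) * bil l l := by
  simp only [algMetric, bil, Matrix.smul_apply, smul_eq_mul]; ring

theorem mfderiv_smul_add_smul {P Q : M → ℝ} (hP : ContMDiff (𝓡 2) 𝓘(ℝ, ℝ) ∞ P)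
    (hQ : ContMDiff (𝓡 2) 𝓘(ℝ, ℝ) ∞ Q) (w z : Plane) (x : M) (v : TangentSpace (𝓡 2) x) :
    mfderiv (𝓡 2) (𝓡 2) (fun y => P y • w + Q y • z) x v =
      (dirDeriv P x v • w + dirDeriv Q x v • z : Plane) := by
  have hd : ∀ {f : M → ℝ}, ContMDiff (𝓡 2) 𝓘(ℝ, ℝ) ∞ f → ∀ w : Plane,
      HasMFDerivAt (𝓡 2) (𝓡 2) (fun y => f y • w) x
        ((ContinuousLinearMap.toSpanSingleton ℝ w).comp
          (mfderiv (𝓡 2) 𝓘(ℝ, ℝ) f x : Plane →L[ℝ] ℝ)) := fun {f} hf w =>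
    (ContinuousLinearMap.toSpanSingleton ℝ w).hasMFDerivAt.comp x
      (hf.mdifferentiableAt (by simp) (x := x)).hasMFDerivAt
  have h := ((hd hP w).add (hd hQ z)).mfderiv
  exact congrArg (fun L : Plane →L[ℝ] Plane => L v) h

variable [IsManifold (𝓡 2) ∞ M]

/-- The inverse function theorem for maps of a surface into the plane. -/
theorem isLocalDiffeomorph_of_mfderiv_injective {φ : M → Plane}
    (hφ : ContMDiff (𝓡 2) (𝓡 2) ∞ φ)
    (hinj : ∀ x, Function.Injective (mfderiv (𝓡 2) (𝓡 2) φ x)) :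
    IsLocalDiffeomorph (𝓡 2) (𝓡 2) ∞ φ := by
  intro x
  have he := chart_mem_atlas Plane x
  have hx := mem_chart_source Plane x
  set e := chartAt Plane x
  have hemax := IsManifold.subset_maximalAtlas (I := 𝓡 2) (n := ∞) he
  have hψ : ContDiffOn ℝ ∞ (φ ∘ e.symm) e.target :=
    contMDiffOn_iff_contDiffOn.1 (hφ.comp_contMDiffOn (contMDiffOn_symm_of_mem_maximalAtlas hemax))
  have hψat : ∀ u ∈ e.target, ContDiffAt ℝ ∞ (φ ∘ e.symm) u := fun u hu =>
    hψ.contDiffAt (e.open_target.mem_nhds hu)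
  -- Invertibility is needed at every point, not only at `e x`: smoothness of the local inverse is
  -- checked on its whole domain.
  have hder : ∀ u ∈ e.target, ∃ L : Plane ≃L[ℝ] Plane,
      HasFDerivAt (φ ∘ e.symm) (L : Plane →L[ℝ] Plane) u := by
    intro u hu
    have hcomp := mfderiv_comp u (hφ.mdifferentiableAt (by simp) (x := e.symm u))
      ((mdifferentiable_of_mem_atlas_plane he).mdifferentiableAt_symm hu)
    rw [mfderiv_eq_fderiv] at hcomp
    have hi : Function.Injective (fderiv ℝ (φ ∘ e.symm) u) := by
      intro v w hvw
      have hv := congrArg (fun L : Plane →L[ℝ] Plane => L v) hcomp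
      have hw := congrArg (fun L : Plane →L[ℝ] Plane => L w) hcomp
      exact mfderiv_symm_injective he hu (hinj _ (hv.symm.trans (hvw.trans hw)))
    refine ⟨(LinearEquiv.ofInjectiveEndo (fderiv ℝ (φ ∘ e.symm) u : Plane →ₗ[ℝ] Plane)
      hi).toContinuousLinearEquiv, ?_⟩
    exact ((hψat u hu).differentiableAt (by simp)).hasFDerivAt.congr_fderiv rfl
  obtain ⟨L, hL⟩ := hder (e x) (e.map_source hx)
  set Φ := (hψat (e x) (e.map_source hx)).toOpenPartialHomeomorph (φ ∘ e.symm) hL (by simp) with hΦ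
  have hΦcoe : ∀ u, Φ u = φ (e.symm u) := fun u => rfl
  have hΦx : e x ∈ Φ.source :=
    (hψat (e x) (e.map_source hx)).mem_toOpenPartialHomeomorph_source hL (by simp)
  have heq : ∀ y ∈ (e.trans Φ).source, φ y = (e.trans Φ) y := by
    intro y hy
    rw [OpenPartialHomeomorph.trans_source] at hy
    rw [OpenPartialHomeomorph.coe_trans, Function.comp_apply, hΦcoe, e.left_inv hy.1]
  refine ⟨⟨(e.trans Φ).toPartialEquiv, (e.trans Φ).open_source, (e.trans Φ).open_target, ?_, ?_⟩,
    ?_, heq⟩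
  · exact hφ.contMDiffOn.congr fun y hy => (heq y hy).symm
  · intro y hy
    have hy' : y ∈ Φ.target ∩ Φ.symm ⁻¹' e.target := by
      rw [← OpenPartialHomeomorph.trans_target]; exact hy
    obtain ⟨L', hL'⟩ := hder _ hy'.2
    have h1 : ContDiffAt ℝ ∞ Φ.symm y := Φ.contDiffAt_symm hy'.1 hL' (hψat _ hy'.2)
    have h2 : ContMDiffAt (𝓡 2) (𝓡 2) ∞ e.symm (Φ.symm y) :=
      (contMDiffOn_symm_of_mem_maximalAtlas hemax).contMDiffAt (e.open_target.mem_nhds hy'.2)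
    exact (h2.comp y h1.contMDiffAt).contMDiffWithinAt
  · rw [OpenPartialHomeomorph.trans_source]
    exact ⟨hx, hΦx⟩

end Surface

end NearlyKahlerSL2

/-! ### The congruence with the model. -/

theorem proposition4p2 {M : Type*} [TopologicalSpace M] [ConnectedSpace M]
    [ChartedSpace NearlyKahlerSL2.Plane M] [IsManifold (𝓡 2) ∞ M]
    (F : M → NearlyKahlerSL2.SL2 × NearlyKahlerSL2.SL2)
    (hF : NearlyKahlerSL2.IsAlmostComplexSurface F)
    (hpos : NearlyKahlerSL2.HasPosDefMetric F)
    (hgeod : NearlyKahlerSL2.IsTotallyGeodesic F)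
    (hflat : NearlyKahlerSL2.IsFlat F) :
    ∃ (a b c : NearlyKahlerSL2.SL2) (φ : M → NearlyKahlerSL2.Plane),
      IsLocalDiffeomorph (𝓡 2) (𝓡 2) ∞ φ ∧
      (∀ (x : M) (v w : TangentSpace (𝓡 2) x),
        NearlyKahlerSL2.inducedMetric F x v w =
          inner (E := NearlyKahlerSL2.Plane) ℝ
            (mfderiv (𝓡 2) (𝓡 2) φ x v) (mfderiv (𝓡 2) (𝓡 2) φ x w)) ∧
      ∀ x, F x = NearlyKahlerSL2.congruence a b c (NearlyKahlerSL2.model (φ x)) := by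
  open NearlyKahlerSL2 in
  obtain ⟨l, hl, hl', hline⟩ := exists_line_forall_differential hF hpos hgeod hflat
  obtain ⟨n, r, hn⟩ := exists_conj_diagGen hl hl'
  obtain ⟨a, P, hP, hFP, hdP⟩ := exists_eq_mul_expDiag_mul (A := fun x => (F x).1) n
    (fun i j => (hF.smooth i j).1) (fun x v => by
      obtain ⟨p, q, h⟩ := hline x v
      exact ⟨p * r, by rw [mul_smul, ← hn]; exact congrArg Prod.fst h⟩)
  -- The same `n` serves both factors, as `congruence` requires a common right factor.
  obtain ⟨b, Q, hQ, hFQ, hdQ⟩ := exists_eq_mul_expDiag_mul (A := fun x => (F x).2) n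
    (fun i j => (hF.smooth i j).2) (fun x v => by
      obtain ⟨p, q, h⟩ := hline x v
      exact ⟨q * r, by rw [mul_smul, ← hn]; exact congrArg Prod.snd h⟩)
  have h2 : √2 ^ 2 = 2 := Real.sq_sqrt (by norm_num)
  have h3 : √3 ^ 2 = 3 := Real.sq_sqrt (by norm_num)
  have h20 : √2 ≠ 0 := by positivity
  have h30 : √3 ≠ 0 := by positivity
  -- `w` and `z` are the points where the exponents `((√3 s - t) / √2, (√3 s + t) / √2)` of the
  -- model equal `(1, 0)` and `(0, 1)`, so the exponents at `P • w + Q • z` are `P` and `Q`.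
  set w : Plane := !₂[1 / (√2 * √3), -1 / √2] with hw
  set z : Plane := !₂[1 / (√2 * √3), 1 / √2] with hz
  -- The Gram matrix of `w`, `z` has entries `2/3` and `-1/3`, exactly the metric on `ℝ l × ℝ l`
  -- when `⟨l, l⟩ = 1`.
  have hinner : ∀ p q p' q' : ℝ, inner ℝ (p • w + q • z) (p' • w + q' • z) =
      2 / 3 * (p * p' + q * q') - 1 / 3 * (q * p' + p * q') := by
    intro p q p' q'
    rw [PiLp.inner_apply, Fin.sum_univ_two]
    simp [hw, hz]
    field_simp
    rw [h2, h3]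
    ring
  have hmetric : ∀ (x : M) (v v' : TangentSpace (𝓡 2) x), inducedMetric F x v v' =
      inner (E := Plane) ℝ (mfderiv (𝓡 2) (𝓡 2) (fun y => P y • w + Q y • z) x v)
        (mfderiv (𝓡 2) (𝓡 2) (fun y => P y • w + Q y • z) x v') := by
    intro x v v'
    rw [mfderiv_smul_add_smul hP hQ, mfderiv_smul_add_smul hP hQ, hinner,
      inducedMetric, metric]
    have hv : ∀ v, leftTriv (F x) (differential F x v) =
        (dirDeriv P x v • ((n : Mat2) * diagGen * ((n⁻¹ : SL2) : Mat2)),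
          dirDeriv Q x v • ((n : Mat2) * diagGen * ((n⁻¹ : SL2) : Mat2))) := fun v =>
      Prod.ext (hdP x v) (hdQ x v)
    rw [hv, hv, algMetric_line_line, bil_conj_diagGen, mul_one]
  refine ⟨a, b, n⁻¹, fun y => P y • w + Q y • z, ?_, hmetric, ?_⟩
  · refine isLocalDiffeomorph_of_mfderiv_injective
      ((hP.smul contMDiff_const).add (hQ.smul contMDiff_const)) fun x => ?_
    -- By the isometry property a kernel vector has length zero in the induced metric, which is
    -- definite.
    refine (injective_iff_map_eq_zero _).2 fun v hv => ?_
    by_contra hne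
    have h := hpos x v hne
    rw [hmetric, hv] at h
    exact lt_irrefl _ (h.trans_eq (inner_zero_left (E := Plane) _))
  · intro x
    refine Prod.ext ((hFP x).trans ?_) ((hFQ x).trans ?_) <;>
    · simp only [congruence, model]
      congr 3
      simp [hw, hz]
      field_simp
      rw [h2]
      ring
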